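/- **Setting.** Let $V$ be a set of individual variables; a state is a map $\omega:V\to\mathbb R$. Terms are built from variables and rational numerals with $+,\cdot,-$. Differential game logic ($\mathrm{dGL}$) has formulas $\varphi::=\theta_1=\theta_2\mid\neg\varphi\mid\varphi\wedge\psi\mid\langle\alpha\rangle\varphi$ and games $\alpha::=\mathfrak a[\bar x;\bar\theta]\mid{?\varphi}\mid\alpha\cup\beta\mid\alpha;\beta\mid\alpha^*\mid\alpha^d$, with $[\alpha]\varphi:=\langle\alpha^d\rangle\varphi$. The differential $\mu$-calculus has formulas $\varphi::=X\mid\theta_1=\theta_2\mid\neg\varphi\mid\varphi\wedge\psi\mid\langle\mathfrak a[\bar x;\bar\theta]\rangle\varphi\mid\mu X.\varphi$, with $X$ only positive in the scope of $\mu X$. The semantics are the usual ones (winning regions, least fixpoints, sets of states). The atomic actions $\mathfrak a$ are nondeterministic assignment $x:=*$ and, for every vector field $F$ on $\mathbb R^\ell$ whose components are polynomials with rational coefficients, evolution along $F$ for a time $t\ge 0$ chosen by Angel for which a solution exists. Quantifiers, deterministic assignment (via one fresh auxiliary variable), $\le$ and $\nu$ are the usual abbreviations, and norms are Euclidean. For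 terms $\theta_1,\dots,\theta_\ell$ with variables among $\bar x$, $\bar x'=\theta$ is the action of the vector field with components $\theta_i$. For $\bar x=(x_1,\dots,x_\ell)$, terms $\theta=(\theta_1,\dots,\theta_\ell)$ and a state $\omega$, let $F^\omega(a)=[\![\theta]\!]_{\omega[\bar x\mapsto a]}$. Let $\bar K=\{a\in\mathbb R^\ell:|a|\le K\}$. Write $a\xrightarrow{F,t}_C b$ if $t\ge0$ and there is a continuous $\gamma:[0,t]\to C$ with $\gamma'=F(\gamma)$ on $(0,t)$, $\gamma(0)=a$, $\gamma(t)=b$. Let $\bar x,\bar y,\bar u,\bar z,t,K,s$ be distinct variables, none of which except the $x_i$ occurs in $\theta$. Let $L\theta=(L\theta_1,\dots,L\theta_\ell)$ be the syntactic Lie derivatives $L\theta_j=\sum_i\frac{\partial\theta_j}{\partial x_i}\theta_i$. Define the first-order formula $$G\equiv 0\le t\wedge|\bar x|\le K\wedge|\bar y|\le K\wedge\exists\bar z\,\bigl(|\bar z|\le K\wedge 2|\bar y-\bar x-t\theta|\le t^2\,|(L\theta)[\bar z/\bar x]|\bigr),$$ the $\mu$-calculus formula $$\mathcal R^\mu\equiv\nu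 X.\bigl(G\wedge\exists\bar u\,\langle t:=\tfrac t2\rangle(\langle\bar x:=\bar u\rangle X\wedge\langle\bar y:=\bar u\rangle X)\bigr)$$ and the $\mathrm{dGL}$ formula $$\mathcal R^{G}\equiv\bigl[\bigl(t:=\tfrac t2;(\bar u:=*)^d;(\bar x:=\bar u\cup\bar y:=\bar u)\bigr)^*\bigr]G.$$ **Statement.** 1. For every state $\omega$: $\omega\models G$ iff, with $a=\omega(\bar x)$, $b=\omega(\bar y)$, $\tau=\omega(t)$, $k=\omega(K)$, one has $\tau\ge0$, $|a|\le k$, $|b|\le k$ and $|b-a-\tau F^\omega(a)|\le\frac{\tau^2}{2}\sup_{|z|\le k}|(DF^\omega)(z)F^\omega(z)|$. 2. $\mathcal R^\mu$ is a formula of the differential $\mu$-calculus (its fixpoint variable occurs only positively) without free fixpoint variables, $\mathcal R^G$ is a formula of $\mathrm{dGL}$, and both contain no differential equations. 3. For every state $\omega$ the following are equivalent: (a) $\omega(\bar x)\xrightarrow{F^\omega,\,\omega(t)}_{\overline{\omega(K)}}\omega(\bar y)$; (b) $\omega\models\mathcal R^\mu$; (c) $\omega\models\mathcal R^G$. 4.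 Suppose all variables of $\theta$ are among $\bar x$. The axiom $$\langle\bar x'=\theta\rangle\varphi\;\leftrightarrow\;\exists K\,\exists\bar y\,\exists t\,\bigl(\mathcal R\wedge\langle\bar x:=\bar y\rangle\varphi\bigr)$$ is sound (true in every state) in the differential $\mu$-calculus with $\mathcal R=\mathcal R^\mu$ and in $\mathrm{dGL}$ with $\mathcal R=\mathcal R^G$, for every formula $\varphi$ of the respective logic in which $K,\bar y,t,s$ are not free. In the $\mu$-calculus, $\varphi$ may contain free fixpoint variables provided these are interpreted by sets of states whose membership does not depend on the values of $K,\bar y,t,s$. -/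

import Mathlib

open Set

universe u v

namespace DGL

/-! ### Continuous reachability -/

/-- The state space of an `ℓ`-dimensional differential equation, with the Euclidean norm. -/
abbrev Pt (ℓ : ℕ) : Type := EuclideanSpace ℝ (Fin ℓ)

/-- `b` is `t`-reachable from `a` along `F` in `C`: some integral curve `γ : [0,t] → C` of `F`
runs from `a` to `b` (in particular `0 ≤ t`). Only the restriction of `γ` to `[0,t]` matters. -/
def ReachIn {ℓ : ℕ} (F : Pt ℓ → Pt ℓ) (C : Set (Pt ℓ)) (t : ℝ) (a b : Pt ℓ) : Prop :=
  0 ≤ t ∧ ∃ γ : ℝ → Pt ℓ, ContinuousOn γ (Icc 0 t) ∧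
    (∀ s ∈ Ioo 0 t, HasDerivAt γ (F (γ s)) s) ∧
    (∀ s ∈ Icc 0 t, γ s ∈ C) ∧ γ 0 = a ∧ γ t = b

/-- The closed ball of points of norm at most `K`. -/
abbrev bar (ℓ : ℕ) (K : ℝ) : Set (Pt ℓ) := Metric.closedBall 0 K

/-- The triples `(a, b, t)` with `a, b` in the ball of radius `K` and `t ≥ 0` within the
second-order Taylor bound `|b - a - t F(a)| ≤ (t² / 2) sup_{|z| ≤ K} |(DF · F)(z)|`. -/
def taylorSet {ℓ : ℕ} (F : Pt ℓ → Pt ℓ) (K : ℝ) : Set (Pt ℓ × Pt ℓ × ℝ) :=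
  {p | p.1 ∈ bar ℓ K ∧ p.2.1 ∈ bar ℓ K ∧ 0 ≤ p.2.2 ∧
    ‖p.2.1 - p.1 - p.2.2 • F p.1‖ ≤
      p.2.2 ^ 2 / 2 * ⨆ z : bar ℓ K, ‖fderiv ℝ F (z : Pt ℓ) (F (z : Pt ℓ))‖}

/-! ### Terms -/

/-- Terms of the language of rings over the individual variables `V`, with a numeral for every
rational; they denote exactly the polynomials with rational coefficients. -/
inductive Term (V : Type u) : Type u
  | var (x : V) : Term V
  | const (q : ℚ) : Term V
  | add (a b : Term V) : Term V
  | mul (a b : Term V) : Term V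
  | neg (a : Term V) : Term V

namespace Term

variable {V : Type u}

instance : Zero (Term V) := ⟨.const 0⟩
instance : One (Term V) := ⟨.const 1⟩
instance : Add (Term V) := ⟨.add⟩
instance : Mul (Term V) := ⟨.mul⟩
instance : Neg (Term V) := ⟨.neg⟩
instance : Sub (Term V) := ⟨fun a b => a + -b⟩

/-- The value of a term in a state. -/
def eval (ω : V → ℝ) : Term V → ℝ
  | var x => ω x
  | const q => (q : ℝ)
  | add a b => a.eval ω + b.eval ω
  | mul a b => a.eval ω * b.eval ω
  | neg a => -a.eval ω

/-- The variables of a term. -/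
def fv : Term V → Set V
  | var x => {x}
  | const _ => ∅
  | add a b => a.fv ∪ b.fv
  | mul a b => a.fv ∪ b.fv
  | neg a => a.fv

/-- Simultaneous substitution of terms for variables. -/
def subst (σ : V → Term V) : Term V → Term V
  | var x => σ x
  | const q => const q
  | add a b => a.subst σ + b.subst σ
  | mul a b => a.subst σ * b.subst σ
  | neg a => -a.subst σ

open Classical in
/-- The syntactic partial derivative with respect to the variable `x`. -/
noncomputable def pderiv (x : V) : Term V → Term V
  | var y => if y = x then 1 else 0
  | const _ => 0
  | add a b => a.pderiv x + b.pderiv x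
  | mul a b => a.pderiv x * b + a * b.pderiv x
  | neg a => -a.pderiv x

/-- The sum of finitely many terms. -/
def sum {n : ℕ} (a : Fin n → Term V) : Term V := (List.ofFn a).foldr (fun s p => s + p) 0

/-- The square of the Euclidean norm of a vector of terms. -/
def sqNorm {n : ℕ} (a : Fin n → Term V) : Term V := sum fun i => a i * a i

/-- The syntactic Lie derivative of `δ` along `x' = θ`, that is `∑ i, ∂δ/∂xᵢ · θᵢ`. -/
noncomputable def lie {ℓ : ℕ} (x : Fin ℓ ↪ V) (θ : Fin ℓ → Term V) (δ : Term V) : Term V :=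
  sum fun i => δ.pderiv (x i) * θ i

/-- A term with variables among `x` as a polynomial with rational coefficients
(other variables are sent to `0`). -/
noncomputable def toPoly {ℓ : ℕ} (x : Fin ℓ ↪ V) : Term V → MvPolynomial (Fin ℓ) ℚ
  | var y => Function.extend x MvPolynomial.X (fun _ => 0) y
  | const q => MvPolynomial.C q
  | add a b => a.toPoly x + b.toPoly x
  | mul a b => a.toPoly x * b.toPoly x
  | neg a => -a.toPoly x

end Term

/-- The vector field `a ↦ ⟦θ⟧ ω[x ↦ a]` of `x' = θ`, in the state `ω` giving the values of
parameters. -/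
noncomputable def termField {V : Type u} {ℓ : ℕ} (x : Fin ℓ ↪ V) (θ : Fin ℓ → Term V)
    (ω : V → ℝ) : Pt ℓ → Pt ℓ :=
  fun a => WithLp.toLp 2 fun i => (θ i).eval (Function.extend x (fun j => a j) ω)

/-- The restriction of the state `ω` to the variables `x`, as a point. -/
noncomputable def restr {V : Type u} {ℓ : ℕ} (ω : V → ℝ) (x : Fin ℓ ↪ V) : Pt ℓ :=
  WithLp.toLp 2 fun i => ω (x i)

/-- The vector field of a tuple of polynomials with rational coefficients. -/
noncomputable def polyField {ℓ : ℕ} (F : Fin ℓ → MvPolynomial (Fin ℓ) ℚ) : Pt ℓ → Pt ℓ :=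
  fun a => WithLp.toLp 2 fun i => MvPolynomial.aeval (fun j => a j) (F i)

/-! ### Action symbols -/

/-- Action symbols of arity `(k, l)` (a game affecting `k` variables and depending on `l`
parameters): nondeterministic assignment, and one symbol for every polynomial vector field. -/
inductive Act : ℕ → ℕ → Type
  | star : Act 1 0
  | dyn {ℓ : ℕ} (F : Fin ℓ → MvPolynomial (Fin ℓ) ℚ) : Act ℓ ℓ

/-- The action symbol is not a differential equation symbol. -/
def Act.ODEFree {k l : ℕ} : Act k l → Prop
  | star => True
  | dyn _ => False

/-- The neighbourhood functions interpreting the action symbols: the sets of outcomes into which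
the player Angel can force the game. She may pick any real value in `*`, and any duration of an
existing evolution of the differential equation. -/
def Act.interp {k l : ℕ} : Act k l → (Fin l → ℝ) → Set (Set (Fin k → ℝ))
  | star => fun _ => {E | E.Nonempty}
  | dyn F => fun a => {E | ∃ b ∈ E, ∃ t : ℝ, 0 ≤ t ∧
      ReachIn (polyField F) univ t (WithLp.toLp 2 a) (WithLp.toLp 2 b)}

/-- Angel's winning region for the goal `S` in the atomic game `a` played with parameters `θ`
on the variables `x`. -/
def atomWin {V : Type u} {k l : ℕ} (a : Act k l) (x : Fin k ↪ V) (θ : Fin l → Term V)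
    (S : Set (V → ℝ)) : Set (V → ℝ) :=
  {ω | ∃ E ∈ a.interp (fun i => (θ i).eval ω), ∀ b ∈ E, Function.extend x b ω ∈ S}

/-- A single variable as a sequence of length one. -/
def single {V : Type u} (x : V) : Fin 1 ↪ V := ⟨fun _ => x, fun _ _ _ => Subsingleton.elim _ _⟩

/-! ### First-order formulas -/

/-- First-order formulas over the language of rings. -/
inductive FOForm (V : Type u) : Type u
  | eq (a b : Term V) : FOForm V
  | neg (φ : FOForm V) : FOForm V
  | and (φ ψ : FOForm V) : FOForm V
  | ex (x : V) (φ : FOForm V) : FOForm V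

namespace FOForm

variable {V : Type u}

open Classical in
/-- Satisfaction over the real field. -/
def Sat : FOForm V → (V → ℝ) → Prop
  | eq a b, ω => a.eval ω = b.eval ω
  | neg φ, ω => ¬ φ.Sat ω
  | and φ ψ, ω => φ.Sat ω ∧ ψ.Sat ω
  | ex x φ, ω => ∃ c : ℝ, φ.Sat (Function.update ω x c)

/-- Existential quantification over several variables. -/
def exs (l : List V) (φ : FOForm V) : FOForm V := l.foldr ex φ

/-- `a ≤ b` over the reals, written as `∃ s, b = a + s²` with a variable `s` not in `a, b`. -/
def le (s : V) (a b : Term V) : FOForm V := ex s (eq b (a + Term.var s * Term.var s))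

/-- `|a| ≤ K` for a vector `a` of terms. -/
def ballLe {n : ℕ} (s : V) (a : Fin n → Term V) (K : Term V) : FOForm V :=
  and (le s 0 K) (le s (Term.sqNorm a) (K * K))

end FOForm

/-! ### The differential `μ`-calculus -/

/-- Formulas of the differential `μ`-calculus, with individual variables `V` and fixpoint
variables `W`; the positivity condition on fixpoints is `MuForm.WF`. -/
inductive MuForm (V : Type u) (W : Type v) : Type (max u v)
  | fix (X : W) : MuForm V W
  | eq (a b : Term V) : MuForm V W
  | neg (φ : MuForm V W) : MuForm V W
  | and (φ ψ : MuForm V W) : MuForm V W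
  | dia {k l : ℕ} (a : Act k l) (x : Fin k ↪ V) (θ : Fin l → Term V) (φ : MuForm V W) :
      MuForm V W
  | mu (X : W) (φ : MuForm V W) : MuForm V W

namespace MuForm

variable {V : Type u} {W : Type v}

/-- All free occurrences of `X` have polarity `p` (`true`: positive, `false`: negative). -/
def Polar (X : W) : Bool → MuForm V W → Prop
  | p, fix Y => Y = X → p = true
  | _, eq _ _ => True
  | p, neg φ => Polar X (!p) φ
  | p, and φ ψ => Polar X p φ ∧ Polar X p ψ
  | p, dia _ _ _ φ => Polar X p φ
  | p, mu Y φ => Y ≠ X → Polar X p φ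

/-- Fixpoint variables occur only positively in the fixpoint formulas binding them. -/
def WF : MuForm V W → Prop
  | fix _ => True
  | eq _ _ => True
  | neg φ => φ.WF
  | and φ ψ => φ.WF ∧ ψ.WF
  | dia _ _ _ φ => φ.WF
  | mu X φ => Polar X true φ ∧ φ.WF

/-- No differential equation symbol occurs. -/
def ODEFree : MuForm V W → Prop
  | fix _ => True
  | eq _ _ => True
  | neg φ => φ.ODEFree
  | and φ ψ => φ.ODEFree ∧ ψ.ODEFree
  | dia a _ _ φ => a.ODEFree ∧ φ.ODEFree
  | mu _ φ => φ.ODEFree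

/-- The free individual variables. -/
def fv : MuForm V W → Set V
  | fix _ => ∅
  | eq a b => a.fv ∪ b.fv
  | neg φ => φ.fv
  | and φ ψ => φ.fv ∪ ψ.fv
  | dia _ x θ φ => (⋃ i, (θ i).fv) ∪ (φ.fv \ range x)
  | mu _ φ => φ.fv

/-- The free fixpoint variables. -/
def fixFv : MuForm V W → Set W
  | fix X => {X}
  | eq _ _ => ∅
  | neg φ => φ.fixFv
  | and φ ψ => φ.fixFv ∪ ψ.fixFv
  | dia _ _ _ φ => φ.fixFv
  | mu X φ => φ.fixFv \ {X}

open Classical in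
/-- The set of states satisfying a formula under an interpretation of the fixpoint variables. -/
noncomputable def sem : MuForm V W → (W → Set (V → ℝ)) → Set (V → ℝ)
  | fix X, I => I X
  | eq a b, _ => {ω | a.eval ω = b.eval ω}
  | neg φ, I => (φ.sem I)ᶜ
  | and φ ψ, I => φ.sem I ∩ ψ.sem I
  | dia a x θ φ, I => atomWin a x θ (φ.sem I)
  | mu X φ, I => ⋂₀ {Z | φ.sem (Function.update I X Z) ⊆ Z}

open Classical in
/-- Substitution of `ρ` for the free occurrences of the fixpoint variable `X`. -/
noncomputable def substFix (X : W) (ρ : MuForm V W) : MuForm V W → MuForm V W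
  | fix Y => if Y = X then ρ else fix Y
  | eq a b => eq a b
  | neg φ => neg (substFix X ρ φ)
  | and φ ψ => and (substFix X ρ φ) (substFix X ρ ψ)
  | dia a x θ φ => dia a x θ (substFix X ρ φ)
  | mu Y φ => if Y = X then mu Y φ else mu Y (substFix X ρ φ)

/-- The greatest fixpoint `νX.φ = ¬μX.¬φ[¬X/X]`. -/
noncomputable def nu (X : W) (φ : MuForm V W) : MuForm V W :=
  neg (mu X (neg (substFix X (neg (fix X)) φ)))

/-- The biconditional. -/
def iff (φ ψ : MuForm V W) : MuForm V W :=
  and (neg (and φ (neg ψ))) (neg (and ψ (neg φ)))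

/-- `∃x φ`, that is `⟨x := *⟩φ`. -/
def ex (x : V) (φ : MuForm V W) : MuForm V W := dia .star (single x) Fin.elim0 φ

/-- Existential quantification over several variables. -/
def exs (l : List V) (φ : MuForm V W) : MuForm V W := l.foldr ex φ

/-- `⟨x := θ⟩φ` as the abbreviation `∃s (s = θ ∧ ∃x (x = s ∧ φ))` with a fresh variable `s`. -/
def assign (s x : V) (θ : Term V) (φ : MuForm V W) : MuForm V W :=
  ex s (and (eq (.var s) θ) (ex x (and (eq (.var x) (.var s)) φ)))

/-- `⟨x̄ := ȳ⟩φ` for disjoint sequences of distinct variables. -/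
def assigns {n : ℕ} (s : V) (x y : Fin n ↪ V) (φ : MuForm V W) : MuForm V W :=
  (List.ofFn fun i => (x i, y i)).foldr (fun p ψ => assign s p.1 (.var p.2) ψ) φ

end MuForm

/-- First-order formulas as formulas of the differential `μ`-calculus. -/
def FOForm.toMu {V : Type u} (W : Type v) : FOForm V → MuForm V W
  | eq a b => .eq a b
  | neg φ => .neg (φ.toMu W)
  | and φ ψ => .and (φ.toMu W) (ψ.toMu W)
  | ex x φ => .ex x (φ.toMu W)

/-! ### Differential game logic -/

/-- The two syntactic categories of differential game logic. -/
inductive Kind : Type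
  | form
  | game

/-- Formulas (`Dgl V .form`) and hybrid games (`Dgl V .game`) of differential game logic. -/
inductive Dgl (V : Type u) : Kind → Type u
  | eq (a b : Term V) : Dgl V .form
  | neg (φ : Dgl V .form) : Dgl V .form
  | and (φ ψ : Dgl V .form) : Dgl V .form
  | dia (α : Dgl V .game) (φ : Dgl V .form) : Dgl V .form
  | atom {k l : ℕ} (a : Act k l) (x : Fin k ↪ V) (θ : Fin l → Term V) : Dgl V .game
  | test (φ : Dgl V .form) : Dgl V .game
  | choice (α β : Dgl V .game) : Dgl V .game
  | seq (α β : Dgl V .game) : Dgl V .game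
  | rep (α : Dgl V .game) : Dgl V .game
  | dual (α : Dgl V .game) : Dgl V .game

/-- Formulas denote sets of states, games denote winning region functions. -/
abbrev Kind.Den (V : Type u) : Kind → Type u
  | form => Set (V → ℝ)
  | game => Set (V → ℝ) → Set (V → ℝ)

namespace Dgl

variable {V : Type u}

/-- The denotations of formulas and games. -/
def sem : {κ : Kind} → Dgl V κ → κ.Den V
  | _, eq a b => {ω | a.eval ω = b.eval ω}
  | _, neg φ => φ.semᶜ
  | _, and φ ψ => φ.sem ∩ ψ.sem
  | _, dia α φ => α.sem φ.sem
  | _, atom a x θ => fun S => atomWin a x θ S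
  | _, test φ => fun S => φ.sem ∩ S
  | _, choice α β => fun S => α.sem S ∪ β.sem S
  | _, seq α β => fun S => α.sem (β.sem S)
  | _, rep α => fun S => ⋂₀ {Z | S ∪ α.sem Z ⊆ Z}
  | _, dual α => fun S => (α.sem Sᶜ)ᶜ

/-- The variables necessarily bound by a game (none for formulas). -/
def mbv : {κ : Kind} → Dgl V κ → Set V
  | _, eq _ _ => ∅
  | _, neg _ => ∅
  | _, and _ _ => ∅
  | _, dia _ _ => ∅
  | _, atom _ x _ => range x
  | _, test _ => ∅
  | _, choice α β => α.mbv ∩ β.mbv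
  | _, seq α β => α.mbv ∪ β.mbv
  | _, rep _ => ∅
  | _, dual α => α.mbv

/-- The free variables of formulas and games. -/
def fv : {κ : Kind} → Dgl V κ → Set V
  | _, eq a b => a.fv ∪ b.fv
  | _, neg φ => φ.fv
  | _, and φ ψ => φ.fv ∪ ψ.fv
  | _, dia α φ => α.fv ∪ (φ.fv \ α.mbv)
  | _, atom _ _ θ => ⋃ i, (θ i).fv
  | _, test φ => φ.fv
  | _, choice α β => α.fv ∪ β.fv
  | _, seq α β => α.fv ∪ (β.fv \ α.mbv)
  | _, rep α => α.fv
  | _, dual α => α.fv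

/-- No differential equation symbol occurs. -/
def ODEFree : {κ : Kind} → Dgl V κ → Prop
  | _, eq _ _ => True
  | _, neg φ => φ.ODEFree
  | _, and φ ψ => φ.ODEFree ∧ ψ.ODEFree
  | _, dia α φ => α.ODEFree ∧ φ.ODEFree
  | _, atom a _ _ => a.ODEFree
  | _, test φ => φ.ODEFree
  | _, choice α β => α.ODEFree ∧ β.ODEFree
  | _, seq α β => α.ODEFree ∧ β.ODEFree
  | _, rep α => α.ODEFree
  | _, dual α => α.ODEFree

/-- The box modality `[α]φ`, that is `⟨αᵈ⟩φ`. -/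
def box (α : Dgl V .game) (φ : Dgl V .form) : Dgl V .form := dia (dual α) φ

/-- The biconditional. -/
def iff (φ ψ : Dgl V .form) : Dgl V .form :=
  and (neg (and φ (neg ψ))) (neg (and ψ (neg φ)))

/-- The game `x := *`. -/
def havoc (x : V) : Dgl V .game := atom .star (single x) Fin.elim0

/-- The game that does nothing. -/
def skip : Dgl V .game := test (eq 0 0)

/-- The sequential composition of a list of games. -/
def seqs (l : List (Dgl V .game)) : Dgl V .game := l.foldr seq skip

/-- `∃x φ`, that is `⟨x := *⟩φ`. -/
def ex (x : V) (φ : Dgl V .form) : Dgl V .form := dia (havoc x) φ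

/-- Existential quantification over several variables. -/
def exs (l : List V) (φ : Dgl V .form) : Dgl V .form := l.foldr ex φ

/-- The game `x := θ` as the abbreviation `s := *; ?s = θ; x := *; ?x = s` with a fresh
variable `s`. -/
def assign (s x : V) (θ : Term V) : Dgl V .game :=
  seq (havoc s) (seq (test (eq (.var s) θ)) (seq (havoc x) (test (eq (.var x) (.var s)))))

/-- The game `x̄ := ȳ` for disjoint sequences of distinct variables. -/
def assigns {n : ℕ} (s : V) (x y : Fin n ↪ V) : Dgl V .game :=
  seqs (List.ofFn fun i => assign s (x i) (.var (y i)))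

end Dgl

/-- First-order formulas as formulas of differential game logic. -/
def FOForm.toDgl {V : Type u} : FOForm V → Dgl V .form
  | eq a b => .eq a b
  | neg φ => .neg φ.toDgl
  | and φ ψ => .and φ.toDgl ψ.toDgl
  | ex x φ => .ex x φ.toDgl

/-! ### The formulas describing reachability -/

/-- The roles of the variables in the reachability formulas: the space vectors `x̄, ȳ`, the time
`t` and the bound `K`, and the auxiliary bound variables `ū, z̄` and `s`. An injective assignment
of variables to roles says that all these variables are distinct. -/
inductive Role (ℓ : ℕ) : Type
  | x (i : Fin ℓ)
  | y (i : Fin ℓ)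
  | u (i : Fin ℓ)
  | z (i : Fin ℓ)
  | t
  | K
  | s

section Reach

variable {V : Type u} {ℓ : ℕ}

/-- The variables `x̄`. -/
def xs (r : Role ℓ ↪ V) : Fin ℓ ↪ V :=
  ⟨fun i => r (.x i), fun i j h => by simpa using h⟩

/-- The variables `ȳ`. -/
def ys (r : Role ℓ ↪ V) : Fin ℓ ↪ V :=
  ⟨fun i => r (.y i), fun i j h => by simpa using h⟩

/-- The variables `ū`. -/
def us (r : Role ℓ ↪ V) : Fin ℓ ↪ V :=
  ⟨fun i => r (.u i), fun i j h => by simpa using h⟩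

/-- The variables `z̄`. -/
def zs (r : Role ℓ ↪ V) : Fin ℓ ↪ V :=
  ⟨fun i => r (.z i), fun i j h => by simpa using h⟩

/-- The syntactic Lie derivatives `(L θ₁, …, L θ_ℓ)` of `θ` along `x̄' = θ`, with `z̄` substituted
for `x̄`. -/
noncomputable def lieAtZ (r : Role ℓ ↪ V) (θ : Fin ℓ → Term V) (i : Fin ℓ) : Term V :=
  (Term.lie (xs r) θ (θ i)).subst (Function.extend (xs r) (fun j => Term.var (zs r j)) Term.var)

/-- The first-order Taylor bound formula
`0 ≤ t ∧ |x̄| ≤ K ∧ |ȳ| ≤ K ∧ ∃z̄ (|z̄| ≤ K ∧ 2|ȳ - x̄ - tθ| ≤ t² |(Lθ)[z̄/x̄]|)`,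
the last inequality between norms being written as `4|ȳ - x̄ - tθ|² ≤ (t²)² |(Lθ)[z̄/x̄]|²`. -/
noncomputable def taylorForm (r : Role ℓ ↪ V) (θ : Fin ℓ → Term V) : FOForm V :=
  let s := r .s
  let t := Term.var (r .t)
  let K := Term.var (r .K)
  .and (.le s 0 t) <|
  .and (.ballLe s (fun i => .var (xs r i)) K) <|
  .and (.ballLe s (fun i => .var (ys r i)) K) <|
  .exs (List.ofFn (zs r)) <|
  .and (.ballLe s (fun i => .var (zs r i)) K) <|
  .le s (.const 4 * Term.sqNorm fun i => .var (ys r i) - .var (xs r i) - t * θ i)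
    ((t * t) * (t * t) * Term.sqNorm (lieAtZ r θ))

/-- The term `t / 2`. -/
def halfT (r : Role ℓ ↪ V) : Term V := .const (1 / 2) * .var (r .t)

/-- Reachability as a greatest fixpoint in the differential `μ`-calculus:
`νX.(G ∧ ∃ū ⟨t := t/2⟩(⟨x̄ := ū⟩X ∧ ⟨ȳ := ū⟩X))` with the Taylor bound formula `G`. -/
noncomputable def reachMu {W : Type v} (r : Role ℓ ↪ V) (X : W) (θ : Fin ℓ → Term V) :
    MuForm V W :=
  .nu X <| .and ((taylorForm r θ).toMu W) <| .exs (List.ofFn (us r)) <|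
    .assign (r .s) (r .t) (halfT r) <|
      .and (.assigns (r .s) (xs r) (us r) (.fix X)) (.assigns (r .s) (ys r) (us r) (.fix X))

/-- Reachability as a game in differential game logic:
`[(t := t/2; (ū := *)ᵈ; (x̄ := ū ∪ ȳ := ū))*] G` with the Taylor bound formula `G`. -/
noncomputable def reachDgl (r : Role ℓ ↪ V) (θ : Fin ℓ → Term V) : Dgl V .form :=
  .box
    (.rep (.seq (.assign (r .s) (r .t) (halfT r))
      (.seq (.dual (.seqs (List.ofFn fun i => .havoc (us r i))))
        (.choice (.assigns (r .s) (xs r) (us r)) (.assigns (r .s) (ys r) (us r))))))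
    (taylorForm r θ).toDgl

/-! ### The fixpoint axiom for differential equations -/

/-- The vector field symbol of `x̄' = θ`, where the variables of `θ` are among `x̄`. -/
noncomputable def odeAct (x : Fin ℓ ↪ V) (θ : Fin ℓ → Term V) : Act ℓ ℓ :=
  .dyn fun i => (θ i).toPoly x

/-- `⟨x̄' = θ⟩φ ↔ ∃K ∃ȳ ∃t (R ∧ ⟨x̄ := ȳ⟩φ)` in the differential `μ`-calculus, with
`R` the greatest fixpoint formula for reachability. -/
noncomputable def nablaMu {W : Type v} (r : Role ℓ ↪ V) (X : W) (θ : Fin ℓ → Term V)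
    (φ : MuForm V W) : MuForm V W :=
  .iff (.dia (odeAct (xs r) θ) (xs r) (fun i => .var (xs r i)) φ)
    (.ex (r .K) <| .exs (List.ofFn (ys r)) <| .ex (r .t) <|
      .and (reachMu r X θ) (.assigns (r .s) (xs r) (ys r) φ))

/-- `⟨x̄' = θ⟩φ ↔ ∃K ∃ȳ ∃t (R ∧ ⟨x̄ := ȳ⟩φ)` in differential game logic, with `R` the game formula
for reachability. -/
noncomputable def nablaDgl (r : Role ℓ ↪ V) (θ : Fin ℓ → Term V) (φ : Dgl V .form) :
    Dgl V .form :=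
  .iff (.dia (.atom (odeAct (xs r) θ) (xs r) (fun i => .var (xs r i))) φ)
    (.ex (r .K) <| .exs (List.ofFn (ys r)) <| .ex (r .t) <|
      .and (reachDgl r θ) (.dia (.assigns (r .s) (xs r) (ys r)) φ))

/-- The variables bound around `φ` on the right-hand side of the axiom: `K, ȳ, t` and the
auxiliary variable of the assignment. They have to be fresh for `φ`. -/
def nablaBound (r : Role ℓ ↪ V) : Set V := {r .K, r .t, r .s} ∪ range (ys r)

end Reach

end DGL

namespace DGL

/-! Bounded reachability is the greatest relation that satisfies the Taylor bound and is closed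
under taking midpoints. It has both properties: along an integral curve the velocity `F ∘ γ` has
derivative `DF · F`, so integrating twice gives the Taylor bound (`ReachIn.mem_taylorSet`), and the
point at half time is a midpoint (`ReachIn.exists_split`). Conversely, let `R` be any relation with
both properties. After `n` halvings, a triple `(a, b, t)` in `R` becomes a chain of `2 ^ n` steps,
each with an error quadratic in `t / 2 ^ n`. Grönwall's inequality controls how these errors
propagate, so the total error is of order `2 ^ (-n)`. Hence `b` is the endpoint of the exact
solution from `a`, all chain points lie on that solution, and since the ball is closed the whole
solution stays inside it (`reachIn_of_midpoints`).

Each of the two formulas says that the state lies in some set of states that satisfy the Taylor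
formula and have midpoints within the set. For `ν` this is the description of a greatest fixpoint as
a union of postfixed sets. In the box game the opponent picks the half, so both halves must succeed,
while the dualised `ū := *` lets the other player pick the midpoint. `OnlyX.subset_reachSet` and
`OnlyX.exists_midpoint` carry the analytic facts over to states and serve both logics.

For the axiom, a trajectory over a compact time interval is bounded, so some `K` works. Jumping to
`ȳ` then gives the outcome of the evolution except for the values of `K, ȳ, t, s`, which the truth
of `φ` does not depend on (`MuForm.indep_sem`, `Dgl.indep_sem`). -/

open Filter Topology

/-! ### Integral curves: Taylor bound, splitting, Grönwall, existence -/

section Curves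

variable {ℓ : ℕ} {F : Pt ℓ → Pt ℓ} {C : Set (Pt ℓ)}

/-- `γ` is an integral curve of `F` on `[0,t]`. -/
def Curve (F : Pt ℓ → Pt ℓ) (t : ℝ) (γ : ℝ → Pt ℓ) : Prop :=
  ContinuousOn γ (Icc 0 t) ∧ ∀ s ∈ Ioo 0 t, HasDerivAt γ (F (γ s)) s

theorem Curve.mono {t t' : ℝ} {γ : ℝ → Pt ℓ} (h : Curve F t γ) (ht : t' ≤ t) : Curve F t' γ :=
  ⟨h.1.mono (Icc_subset_Icc_right ht), fun s hs => h.2 s (Ioo_subset_Ioo_right ht hs)⟩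

theorem Curve.shift {t c t' : ℝ} {γ : ℝ → Pt ℓ} (h : Curve F t γ) (hc : 0 ≤ c) (ht : c + t' ≤ t) :
    Curve F t' (fun s => γ (s + c)) := by
  refine ⟨h.1.comp (by fun_prop) fun s hs => ⟨by linarith [hs.1], by linarith [hs.2]⟩,
    fun s hs => ?_⟩
  exact (h.2 (s + c) ⟨by linarith [hs.1], by linarith [hs.2]⟩).comp_add_const s c

/-- At `s = 0` no derivative is assumed. The right derivative there is the limit of `F ∘ γ` from the
right, which exists by continuity of `γ` and `F`. -/
theorem Curve.hasDerivWithinAt {t : ℝ} {γ : ℝ → Pt ℓ} (h : Curve F t γ) (hF : Continuous F)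
    {s : ℝ} (hs : s ∈ Ico 0 t) : HasDerivWithinAt γ (F (γ s)) (Ici s) s := by
  have hd : ∀ x ∈ Ioo s t, HasDerivAt γ (F (γ x)) x := fun x hx =>
    h.2 x ⟨hs.1.trans_lt hx.1, hx.2⟩
  have hcont : ContinuousWithinAt γ (Ioo s t) s :=
    (h.1 s ⟨hs.1, hs.2.le⟩).mono fun x hx => ⟨hs.1.trans hx.1.le, hx.2.le⟩
  have hmem : Ioo s t ∈ 𝓝[>] s := Ioo_mem_nhdsGT hs.2
  refine hasDerivWithinAt_Ici_of_tendsto_deriv (s := Ioo s t)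
    (fun x hx => (hd x hx).differentiableAt.differentiableWithinAt) hcont hmem ?_
  have hlim : Tendsto (fun x => F (γ x)) (𝓝[>] s) (𝓝 (F (γ s))) := by
    refine (hF.tendsto _).comp ?_
    have := hcont.tendsto
    rwa [nhdsWithin_Ioo_eq_nhdsGT hs.2] at this
  refine hlim.congr' ?_
  filter_upwards [hmem] with x hx using (hd x hx).deriv.symm

/-- If the velocity changes at most linearly with slope `M`, the curve stays within `M t² / 2` of
its tangent. -/
theorem Curve.norm_sub_tangent_le {t M : ℝ} {γ : ℝ → Pt ℓ} (h : Curve F t γ) (hF : Continuous F)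
    (ht : 0 ≤ t) (hM : ∀ s ∈ Icc 0 t, ‖F (γ s) - F (γ 0)‖ ≤ M * s) :
    ‖γ t - γ 0 - t • F (γ 0)‖ ≤ t ^ 2 / 2 * M := by
  have := image_norm_le_of_norm_deriv_right_le_deriv_boundary (a := 0) (b := t)
    (f := fun s => γ s - γ 0 - s • F (γ 0)) (f' := fun s => F (γ s) - F (γ 0))
    (B := fun s => s ^ 2 / 2 * M) (B' := fun s => M * s)
    ((h.1.sub continuousOn_const).sub (by fun_prop))
    (fun s hs => by
      have h1 := (h.hasDerivWithinAt hF hs).sub_const (γ 0)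
      have h2 := ((hasDerivAt_id s).smul_const (F (γ 0))).hasDerivWithinAt (s := Ici s)
      simpa using! h1.sub h2)
    (by simp)
    (fun s => by
      have := (((hasDerivAt_id s).pow 2).div_const 2).mul_const M
      refine this.congr_deriv ?_
      simp; ring)
    (fun s hs => hM s ⟨hs.1, hs.2.le⟩) (x := t) ⟨ht, le_rfl⟩
  simpa using this

theorem Curve.norm_sub_le {t B : ℝ} {γ : ℝ → Pt ℓ} (h : Curve F t γ) (hF : Continuous F)
    (hB : ∀ s ∈ Icc 0 t, ‖F (γ s)‖ ≤ B) {s : ℝ} (hs : s ∈ Icc 0 t) : ‖γ s - γ 0‖ ≤ B * s := by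
  have := norm_image_sub_le_of_norm_deriv_right_le_segment (f := γ) (f' := fun s => F (γ s))
    h.1 (fun s hs => h.hasDerivWithinAt hF hs) (C := B) (fun s hs => hB s ⟨hs.1, hs.2.le⟩) s hs
  simpa using this

theorem norm_fderiv_le_iSup (hF : ContDiff ℝ 1 F) {K : ℝ} {z : Pt ℓ} (hz : z ∈ bar ℓ K) :
    ‖fderiv ℝ F z (F z)‖ ≤ ⨆ z : bar ℓ K, ‖fderiv ℝ F (z : Pt ℓ) (F (z : Pt ℓ))‖ := by
  have hc : Continuous fun z => ‖fderiv ℝ F z (F z)‖ :=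
    ((hF.continuous_fderiv (by simp)).clm_apply hF.continuous).norm
  -- Boundedness is essential: a real supremum over an unbounded family takes the default value `0`.
  have hb : BddAbove (range fun z : bar ℓ K => ‖fderiv ℝ F (z : Pt ℓ) (F (z : Pt ℓ))‖) := by
    have := ((isCompact_closedBall (0 : Pt ℓ) K).image hc).bddAbove
    refine this.mono ?_
    rintro _ ⟨w, rfl⟩
    exact ⟨w, w.2, rfl⟩
  exact le_ciSup hb ⟨z, hz⟩

/-- Compactness makes the supremum a maximum, which is why the first-order formula can express it by
`∃z̄`. -/
theorem exists_norm_fderiv_eq_iSup (hF : ContDiff ℝ 1 F) {K : ℝ} (hK : 0 ≤ K) :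
    ∃ z ∈ bar ℓ K,
      (⨆ z : bar ℓ K, ‖fderiv ℝ F (z : Pt ℓ) (F (z : Pt ℓ))‖) = ‖fderiv ℝ F z (F z)‖ := by
  have hc : Continuous fun z => ‖fderiv ℝ F z (F z)‖ :=
    ((hF.continuous_fderiv (by simp)).clm_apply hF.continuous).norm
  obtain ⟨z, hz, hmax⟩ := (isCompact_closedBall (0 : Pt ℓ) K).exists_isMaxOn
    ⟨0, by simpa using hK⟩ hc.continuousOn
  have : Nonempty (bar ℓ K) := ⟨⟨z, hz⟩⟩
  exact ⟨z, hz, le_antisymm (ciSup_le fun w => hmax w.2) (norm_fderiv_le_iSup hF hz)⟩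

theorem ReachIn.mem_taylorSet (hF : ContDiff ℝ 1 F) {K t : ℝ} {a b : Pt ℓ}
    (h : ReachIn F (bar ℓ K) t a b) : (a, b, t) ∈ taylorSet F K := by
  obtain ⟨ht, γ, hc, hd, hK, rfl, rfl⟩ := h
  have hγ : Curve F t γ := ⟨hc, hd⟩
  refine ⟨hK 0 ⟨le_rfl, ht⟩, hK t ⟨ht, le_rfl⟩, ht, ?_⟩
  refine hγ.norm_sub_tangent_le hF.continuous ht fun s hs => ?_
  -- By the chain rule `F ∘ γ` has derivative `DF · F` along the curve, so the velocity varies at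
  -- most linearly in time.
  have := norm_image_sub_le_of_norm_deriv_right_le_segment (f := fun s => F (γ s))
    (f' := fun s => fderiv ℝ F (γ s) (F (γ s))) (hF.continuous.comp_continuousOn hγ.1)
    (fun s hs => (hF.differentiable (by simp) (γ s)).hasFDerivAt.comp_hasDerivWithinAt s
      (hγ.hasDerivWithinAt hF.continuous hs))
    (fun s hs => norm_fderiv_le_iSup hF (hK s ⟨hs.1, hs.2.le⟩)) s hs
  simpa using this

theorem ReachIn.exists_split {s t : ℝ} {a b : Pt ℓ} (h : ReachIn F C (s + t) a b)
    (hs : 0 ≤ s) (ht : 0 ≤ t) : ∃ u, ReachIn F C s a u ∧ ReachIn F C t u b := by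
  obtain ⟨-, γ, hc, hd, hK, rfl, rfl⟩ := h
  have hγ : Curve F (s + t) γ := ⟨hc, hd⟩
  have h1 : Curve F s γ := hγ.mono (by linarith)
  have h2 := hγ.shift hs le_rfl
  refine ⟨γ s, ⟨hs, γ, h1.1, h1.2, fun x hx => hK x ⟨hx.1, by linarith [hx.2]⟩, rfl, rfl⟩,
    ⟨ht, _, h2.1, h2.2, fun x hx => hK _ ⟨by linarith [hx.1], by linarith [hx.2]⟩, ?_, ?_⟩⟩
  · simp
  · simp [add_comm]

theorem ReachIn.exists_bar {t : ℝ} {a b : Pt ℓ} (h : ReachIn F univ t a b) :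
    ∃ K, ReachIn F (bar ℓ K) t a b := by
  obtain ⟨ht, γ, hc, hd, -, h0, h1⟩ := h
  obtain ⟨K, hK⟩ := (isCompact_Icc.image_of_continuousOn hc).isBounded.subset_closedBall 0
  exact ⟨K, ht, γ, hc, hd, fun s hs => hK ⟨s, hs, rfl⟩, h0, h1⟩

theorem ReachIn.mono {C' : Set (Pt ℓ)} (hC : C ⊆ C') {t : ℝ} {a b : Pt ℓ}
    (h : ReachIn F C t a b) : ReachIn F C' t a b := by
  obtain ⟨ht, γ, hc, hd, hK, h0, h1⟩ := h
  exact ⟨ht, γ, hc, hd, fun s hs => hC (hK s hs), h0, h1⟩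

theorem Curve.dist_le {L : NNReal} (hL : LipschitzWith L F) {t : ℝ} (ht : 0 ≤ t)
    {γ δ : ℝ → Pt ℓ} (hγ : Curve F t γ) (hδ : Curve F t δ) :
    ‖γ t - δ t‖ ≤ ‖γ 0 - δ 0‖ * Real.exp (L * t) := by
  have := dist_le_of_trajectories_ODE (v := fun _ => F) (fun _ => hL) hγ.1
    (fun s hs => hγ.hasDerivWithinAt hL.continuous hs) hδ.1
    (fun s hs => hδ.hasDerivWithinAt hL.continuous hs) (le_refl (dist (γ 0) (δ 0))) t ⟨ht, le_rfl⟩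
  simpa [dist_eq_norm] using this

/-- With speed at most `B` a curve cannot leave the ball of radius `B * t` around `a` before time
`t`. Picard–Lindelöf on that ball therefore covers all of `[0, t]` at once. -/
theorem exists_curve {L : NNReal} (hL : LipschitzWith L F) {B : NNReal} (hB : ∀ z, ‖F z‖ ≤ B)
    {t : ℝ} (ht : 0 ≤ t) (a : Pt ℓ) : ∃ γ, Curve F t γ ∧ γ 0 = a := by
  have hp : IsPicardLindelof (fun _ => F) (tmin := 0) (tmax := t) ⟨0, le_rfl, ht⟩ a
      (B * ⟨t, ht⟩) 0 B L :=
    .of_time_independent (fun x _ => hB x) hL.lipschitzOnWith (by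
      simp only [sub_zero, NNReal.coe_zero, sub_self]
      rw [max_eq_left ht]
      exact le_rfl)
  obtain ⟨γ, h0, hγ⟩ := hp.exists_eq_forall_mem_Icc_hasDerivWithinAt₀
  exact ⟨γ, ⟨fun s hs => (hγ s hs).continuousWithinAt, fun s hs =>
    (hγ s ⟨hs.1.le, hs.2.le⟩).hasDerivAt (Icc_mem_nhds hs.1 hs.2)⟩, h0⟩

end Curves

/-! ### Relations with midpoints are contained in the flow -/

section Midpoints

variable {ℓ : ℕ} {F : Pt ℓ → Pt ℓ}

/-- A relation with midpoints which is a second-order approximation of the flow is contained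
in the flow. -/
theorem norm_sub_le_of_midpoints {L : NNReal} (hL : LipschitzWith L F) {B : NNReal}
    (hB : ∀ z, ‖F z‖ ≤ B) {M : ℝ} {R : Pt ℓ → Pt ℓ → ℝ → Prop}
    (hR0 : ∀ a b t, R a b t → 0 ≤ t)
    (hR1 : ∀ a b t, R a b t → ‖b - a - t • F a‖ ≤ t ^ 2 / 2 * M)
    (hR2 : ∀ a b t, R a b t → ∃ u, R a u (t / 2) ∧ R u b (t / 2)) (n : ℕ) :
    ∀ a b t, R a b t → ∀ γ, Curve F t γ → γ 0 = a →
      ‖b - γ t‖ ≤ (|M| + L * B) * t ^ 2 * Real.exp (L * t) / 2 ^ n := by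
  induction n with
  | zero =>
    rintro a b t hR γ hγ rfl
    have ht := hR0 _ _ _ hR
    have h1 := hR1 _ _ _ hR
    -- Without subdivision, `b` and `γ t` are both compared with the tangent at the starting point;
    -- `F ∘ γ` is Lipschitz in time with constant `L * B`.
    have h2 := hγ.norm_sub_tangent_le (M := L * B) hL.continuous ht fun s hs => by
      refine (hL.norm_sub_le _ _).trans ?_
      rw [mul_assoc]
      exact mul_le_mul_of_nonneg_left
        (hγ.norm_sub_le hL.continuous (fun s _ => hB _) hs) L.2
    have h3 : ‖b - γ t‖ ≤ ‖b - γ 0 - t • F (γ 0)‖ + ‖γ t - γ 0 - t • F (γ 0)‖ := by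
      refine le_of_eq_of_le ?_ (norm_sub_le _ _)
      congr 1; abel
    have h4 : 1 ≤ Real.exp (L * t) := Real.one_le_exp (mul_nonneg L.2 ht)
    have hLB : (0 : ℝ) ≤ L * B := mul_nonneg L.2 B.2
    have h5 : 0 ≤ (|M| + L * B) * t ^ 2 := by positivity
    have h6 : t ^ 2 / 2 * M ≤ t ^ 2 / 2 * |M| := by gcongr; exact le_abs_self M
    have h7 := mul_le_mul_of_nonneg_left h4 h5
    simp only [pow_zero, div_one]
    nlinarith
  | succ n ih =>
    rintro a b t hR γ hγ rfl
    have ht := hR0 _ _ _ hR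
    obtain ⟨u, hu1, hu2⟩ := hR2 _ _ _ hR
    have hsh := hγ.shift (c := t / 2) (t' := t / 2) (by linarith) (by linarith)
    have i1 := ih _ _ _ hu1 γ (hγ.mono (by linarith)) rfl
    -- The exact curve from the approximate midpoint `u` separates the new error of the second half
    -- from the error of the first half, which Grönwall magnifies by at most `e`.
    obtain ⟨δ, hδ, rfl⟩ := exists_curve hL hB (t := t / 2) (by linarith) u
    have i2 := ih _ _ _ hu2 δ hδ rfl
    have i3 := hδ.dist_le hL (by linarith) hsh
    simp only [zero_add, add_halves] at i3
    set e := Real.exp (L * (t / 2)) with he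
    have hee : Real.exp (L * t) = e * e := by rw [he, ← Real.exp_add]; ring_nf
    have he1 : 1 ≤ e := Real.one_le_exp (mul_nonneg L.2 (by linarith))
    have h3 : ‖b - γ t‖ ≤ ‖b - δ (t / 2)‖ + ‖δ (t / 2) - γ t‖ := norm_sub_le_norm_sub_add_norm_sub _ _ _
    have h4 := i3.trans (mul_le_mul_of_nonneg_right i1 (by positivity))
    have hLB : (0 : ℝ) ≤ L * B := mul_nonneg L.2 B.2
    have hA : 0 ≤ (|M| + L * B) * t ^ 2 / 4 / 2 ^ n := by positivity
    rw [hee]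
    -- Halving `t` divides `t ^ 2` by 4, and the two halves together cost at most `2 * e ^ 2`: each
    -- subdivision gains a factor 2.
    calc ‖b - γ t‖ ≤ (|M| + L * B) * t ^ 2 / 4 / 2 ^ n * (e + e * e) := by
          refine (h3.trans (add_le_add i2 h4)).trans (le_of_eq ?_); ring
      _ ≤ (|M| + L * B) * t ^ 2 / 4 / 2 ^ n * (2 * (e * e)) := by
          gcongr; nlinarith
      _ = _ := by rw [pow_succ]; field_simp; ring

theorem eq_of_midpoints {L : NNReal} (hL : LipschitzWith L F) {B : NNReal}
    (hB : ∀ z, ‖F z‖ ≤ B) {M : ℝ} {R : Pt ℓ → Pt ℓ → ℝ → Prop}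
    (hR0 : ∀ a b t, R a b t → 0 ≤ t)
    (hR1 : ∀ a b t, R a b t → ‖b - a - t • F a‖ ≤ t ^ 2 / 2 * M)
    (hR2 : ∀ a b t, R a b t → ∃ u, R a u (t / 2) ∧ R u b (t / 2))
    {a b t} (h : R a b t) {γ} (hγ : Curve F t γ) (h0 : γ 0 = a) : γ t = b := by
  have hlim : Tendsto (fun n : ℕ => (|M| + L * B) * t ^ 2 * Real.exp (L * t) / 2 ^ n) atTop
      (𝓝 0) := tendsto_const_nhds.div_atTop (tendsto_pow_atTop_atTop_of_one_lt one_lt_two)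
  have := ge_of_tendsto' hlim fun n =>
    norm_sub_le_of_midpoints hL hB hR0 hR1 hR2 n a b t h γ hγ h0
  exact (sub_eq_zero.1 (norm_le_zero_iff.1 this)).symm

/-- By `eq_of_midpoints` the midpoints provided by `R` are points of the exact curve at dyadic
fractions of `t`. They lie in `C`, these times are dense, and `C` is closed, so the whole curve
stays in `C`. -/
theorem reachIn_of_midpoints_aux {L : NNReal} (hL : LipschitzWith L F) {B : NNReal}
    (hB : ∀ z, ‖F z‖ ≤ B) {M : ℝ} {C : Set (Pt ℓ)} (hC : IsClosed C)
    {R : Pt ℓ → Pt ℓ → ℝ → Prop} (hRC : ∀ a b t, R a b t → a ∈ C)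
    (hR0 : ∀ a b t, R a b t → 0 ≤ t)
    (hR1 : ∀ a b t, R a b t → ‖b - a - t • F a‖ ≤ t ^ 2 / 2 * M)
    (hR2 : ∀ a b t, R a b t → ∃ u, R a u (t / 2) ∧ R u b (t / 2))
    {a b t} (h : R a b t) : ReachIn F C t a b := by
  have key : ∀ n : ℕ, ∀ a b t, R a b t → ∀ γ, Curve F t γ → γ 0 = a → ∀ s ∈ Icc 0 t,
      ∃ s' ∈ Icc 0 t, |s' - s| ≤ t / 2 ^ n ∧ γ s' ∈ C := by
    intro n
    induction n with
    | zero =>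
      rintro a b t hR γ hγ rfl s hs
      refine ⟨0, ⟨le_rfl, hR0 _ _ _ hR⟩, ?_, hRC _ _ _ hR⟩
      rw [zero_sub, abs_neg, abs_of_nonneg hs.1]; simpa using hs.2
    | succ n ih =>
      rintro a b t hR γ hγ rfl s hs
      have ht := hR0 _ _ _ hR
      obtain ⟨u, hu1, hu2⟩ := hR2 _ _ _ hR
      have hg1 := hγ.mono (t' := t / 2) (by linarith)
      have e : t / 2 / 2 ^ n = t / 2 ^ (n + 1) := by rw [pow_succ]; field_simp
      rcases le_total s (t / 2) with h | h
      · obtain ⟨s', hs', h1, h2⟩ := ih _ _ _ hu1 γ hg1 rfl s ⟨hs.1, h⟩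
        exact ⟨s', ⟨hs'.1, by linarith [hs'.2]⟩, e ▸ h1, h2⟩
      · have hu := eq_of_midpoints hL hB hR0 hR1 hR2 hu1 hg1 rfl
        obtain ⟨s', hs', h1, h2⟩ := ih _ _ _ hu2 _
          (hγ.shift (c := t / 2) (t' := t / 2) (by linarith) (by linarith)) (by simpa using hu)
          (s - t / 2) ⟨by linarith, by linarith [hs.2]⟩
        refine ⟨s' + t / 2, ⟨by linarith [hs'.1], by linarith [hs'.2]⟩, ?_, h2⟩
        rw [← e]
        convert h1 using 2
        ring
  have ht := hR0 _ _ _ h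
  obtain ⟨γ, hγ, h0⟩ := exists_curve hL hB ht a
  refine ⟨ht, γ, hγ.1, hγ.2, fun s hs => ?_, h0, eq_of_midpoints hL hB hR0 hR1 hR2 h hγ h0⟩
  choose p hp1 hp2 hp3 using fun n : ℕ => key n a b t h γ hγ h0 s hs
  have hlim : Tendsto p atTop (𝓝 s) := by
    rw [tendsto_iff_norm_sub_tendsto_zero]
    refine squeeze_zero (fun _ => norm_nonneg _) hp2 ?_
    exact tendsto_const_nhds.div_atTop (tendsto_pow_atTop_atTop_of_one_lt one_lt_two)
  have hlim' : Tendsto p atTop (𝓝[Icc 0 t] s) :=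
    tendsto_nhdsWithin_iff.2 ⟨hlim, Eventually.of_forall hp1⟩
  exact hC.mem_of_tendsto ((hγ.1 s hs).tendsto.comp hlim') (Eventually.of_forall hp3)

/-- A relation within the Taylor bound that has midpoints is contained in bounded reachability. -/
theorem reachIn_of_midpoints (hF : ContDiff ℝ 1 F) {K : ℝ} {R : Pt ℓ → Pt ℓ → ℝ → Prop}
    (hR : ∀ a b t, R a b t → (a, b, t) ∈ taylorSet F K)
    (hR2 : ∀ a b t, R a b t → ∃ u, R a u (t / 2) ∧ R u b (t / 2))
    {a b t} (h : R a b t) : ReachIn F (bar ℓ K) t a b := by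
  -- Cutting `F` off outside the ball makes it globally Lipschitz and bounded. The absolute value
  -- keeps the radii positive even if `K` is negative.
  let f : ContDiffBump (0 : Pt ℓ) := ⟨|K| + 1, |K| + 2, by positivity, by linarith⟩
  let G : Pt ℓ → Pt ℓ := fun z => f z • F z
  have hG : ContDiff ℝ 1 G := f.contDiff.smul hF
  have hGs : HasCompactSupport G := f.hasCompactSupport.smul_right
  obtain ⟨L, hL⟩ := hG.lipschitzWith_of_hasCompactSupport hGs (by simp)
  obtain ⟨B, hB⟩ := hGs.exists_bound_of_continuous hG.continuous
  have hGF : ∀ z ∈ bar ℓ K, G z = F z := fun z hz => by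
    have : f z = 1 := f.one_of_mem_closedBall
      (Metric.closedBall_subset_closedBall (by linarith [le_abs_self K]) hz)
    simp [G, this]
  have hB0 : 0 ≤ B := (norm_nonneg _).trans (hB 0)
  -- The Taylor bound evaluates the field only at `a`, in the ball, where `G` and `F` agree; its
  -- constant can remain the supremum for `F`. The curve found for `G` stays in the ball, so it is a
  -- curve of `F`.
  obtain ⟨ht, γ, hc, hd, hK, h0, h1⟩ := reachIn_of_midpoints_aux (F := G) hL (B := ⟨B, hB0⟩) hB
    (C := bar ℓ K) Metric.isClosed_closedBall (R := R) (fun a b t h => (hR a b t h).1)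
    (fun a b t h => (hR a b t h).2.2.1)
    (fun a b t h => by rw [hGF _ (hR a b t h).1]; exact (hR a b t h).2.2.2) hR2 h
  refine ⟨ht, γ, hc, fun s hs => ?_, hK, h0, h1⟩
  rw [← hGF _ (hK s ⟨hs.1.le, hs.2.le⟩)]
  exact hd s hs

end Midpoints

/-! ### Terms as smooth functions and as polynomials -/

section Terms

variable {V : Type u} {ℓ : ℕ}

namespace Term

@[simp] theorem eval_var (ω : V → ℝ) (x : V) : (var x).eval ω = ω x := rfl
@[simp] theorem eval_const (ω : V → ℝ) (q : ℚ) : (const q).eval ω = q := rfl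
@[simp] theorem eval_add (ω : V → ℝ) (a b : Term V) : (a + b).eval ω = a.eval ω + b.eval ω := rfl
@[simp] theorem eval_mul (ω : V → ℝ) (a b : Term V) : (a * b).eval ω = a.eval ω * b.eval ω := rfl
@[simp] theorem eval_neg (ω : V → ℝ) (a : Term V) : (-a).eval ω = -a.eval ω := rfl
@[simp] theorem eval_sub (ω : V → ℝ) (a b : Term V) : (a - b).eval ω = a.eval ω - b.eval ω :=
  (sub_eq_add_neg _ _).symm
@[simp] theorem eval_zero (ω : V → ℝ) : (0 : Term V).eval ω = 0 := Rat.cast_zero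
@[simp] theorem eval_one (ω : V → ℝ) : (1 : Term V).eval ω = 1 := Rat.cast_one

theorem eval_congr {ω η : V → ℝ} {a : Term V} (h : EqOn ω η a.fv) : a.eval ω = a.eval η := by
  induction a with
  | var x => exact h rfl
  | const q => rfl
  | add a b ha hb =>
    simp only [eval, ha (h.mono subset_union_left), hb (h.mono subset_union_right)]
  | mul a b ha hb =>
    simp only [eval, ha (h.mono subset_union_left), hb (h.mono subset_union_right)]
  | neg a ha => simp only [eval, ha h]

theorem eval_subst (ω : V → ℝ) (σ : V → Term V) (a : Term V) :
    (a.subst σ).eval ω = a.eval fun v => (σ v).eval ω := by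
  induction a <;> simp_all [subst, eval]

@[simp] theorem eval_sum {n : ℕ} (ω : V → ℝ) (a : Fin n → Term V) :
    (sum a).eval ω = ∑ i, (a i).eval ω := by
  have h : ∀ l : List (Term V),
      (l.foldr (fun s p => s + p) 0).eval ω = (l.map fun s => s.eval ω).sum := by
    intro l
    induction l with
    | nil => simp
    | cons s l ih => simp [ih]
  rw [sum, h, List.map_ofFn, List.sum_ofFn]
  rfl

theorem eval_sqNorm {n : ℕ} (ω : V → ℝ) (a : Fin n → Term V) :
    (sqNorm a).eval ω = ‖(WithLp.toLp 2 fun i => (a i).eval ω : Pt n)‖ ^ 2 := by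
  rw [EuclideanSpace.norm_sq_eq, sqNorm, eval_sum]
  simp [sq]

/-- The syntactic rules mirror the sum and product rules; a variable outside `x` is a parameter
frozen at its value in `ω`, so it contributes zero. -/
theorem hasFDerivAt_eval (x : Fin ℓ ↪ V) (ω : V → ℝ) (δ : Term V) (z : Pt ℓ) :
    HasFDerivAt (fun a : Pt ℓ => δ.eval (Function.extend x (fun j => a j) ω))
      (∑ i, (δ.pderiv (x i)).eval (Function.extend x (fun j => z j) ω) •
        (EuclideanSpace.proj i : Pt ℓ →L[ℝ] ℝ)) z := by
  induction δ with
  | var y =>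
    by_cases hy : ∃ i, x i = y
    · obtain ⟨i, rfl⟩ := hy
      simp only [eval, x.injective.extend_apply, pderiv, x.injective.eq_iff]
      have : (∑ j, Term.eval (Function.extend x (fun j => z j) ω) (if i = j then 1 else 0) •
          (EuclideanSpace.proj j : Pt ℓ →L[ℝ] ℝ)) = EuclideanSpace.proj i := by
        rw [Finset.sum_eq_single i] <;> simp +contextual [eq_comm]
      rw [this]
      exact (EuclideanSpace.proj i : Pt ℓ →L[ℝ] ℝ).hasFDerivAt
    · have h0 : ∀ i, y ≠ x i := fun i h => hy ⟨i, h.symm⟩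
      simp only [eval, Function.extend_apply' _ _ _ hy, pderiv, if_neg (h0 _), eval_zero,
        zero_smul, Finset.sum_const_zero]
      exact hasFDerivAt_const _ _
  | const q => simpa [eval, pderiv] using hasFDerivAt_const _ _
  | add a b ha hb =>
    refine (ha.add hb).congr_fderiv ?_
    simp [pderiv, add_smul, Finset.sum_add_distrib]
  | mul a b ha hb =>
    refine (ha.mul hb).congr_fderiv ?_
    simp only [pderiv, eval_add, eval_mul, add_smul, Finset.sum_add_distrib, Finset.smul_sum,
      smul_smul]
    rw [add_comm]
    simp only [mul_comm]
  | neg a ha =>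
    refine ha.neg.congr_fderiv ?_
    simp [pderiv]

theorem contDiff_eval (x : Fin ℓ ↪ V) (ω : V → ℝ) (δ : Term V) :
    ContDiff ℝ 1 fun a : Pt ℓ => δ.eval (Function.extend x (fun j => a j) ω) := by
  induction δ with
  | var y =>
    by_cases hy : ∃ i, x i = y
    · obtain ⟨i, rfl⟩ := hy
      simp only [eval, x.injective.extend_apply]
      exact (EuclideanSpace.proj i : Pt ℓ →L[ℝ] ℝ).contDiff
    · simp only [eval, Function.extend_apply' _ _ _ hy]
      exact contDiff_const
  | const q => exact contDiff_const
  | add a b ha hb => exact ha.add hb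
  | mul a b ha hb => exact ha.mul hb
  | neg a ha => exact ha.neg

theorem aeval_toPoly (x : Fin ℓ ↪ V) (ω : V → ℝ) {δ : Term V} (h : δ.fv ⊆ range x)
    (a : Fin ℓ → ℝ) :
    MvPolynomial.aeval a (δ.toPoly x) = δ.eval (Function.extend x a ω) := by
  induction δ with
  | var y =>
    obtain ⟨i, rfl⟩ : y ∈ range x := h rfl
    simp [toPoly, x.injective.extend_apply]
  | const q => simp [toPoly]
  | add p q hp hq =>
    simp [toPoly, eval, hp (subset_union_left.trans h), hq (subset_union_right.trans h)]
  | mul p q hp hq =>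
    simp [toPoly, eval, hp (subset_union_left.trans h), hq (subset_union_right.trans h)]
  | neg p hp => simp [toPoly, eval, hp h]

end Term

theorem contDiff_termField (x : Fin ℓ ↪ V) (θ : Fin ℓ → Term V) (ω : V → ℝ) :
    ContDiff ℝ 1 (termField x θ ω) :=
  contDiff_euclidean.2 fun i => (θ i).contDiff_eval x ω

theorem fderiv_termField (x : Fin ℓ ↪ V) (θ : Fin ℓ → Term V) (ω : V → ℝ) (z : Pt ℓ) (i : Fin ℓ) :
    fderiv ℝ (termField x θ ω) z (termField x θ ω z) i =
      (Term.lie x θ (θ i)).eval (Function.extend x (fun j => z j) ω) := by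
  have h : HasFDerivAt (termField x θ ω) (fderiv ℝ (termField x θ ω) z) z :=
    ((contDiff_termField x θ ω).differentiable (by simp) z).hasFDerivAt
  have h1 := (EuclideanSpace.proj i : Pt ℓ →L[ℝ] ℝ).hasFDerivAt.comp z h
  have h2 := h1.unique ((θ i).hasFDerivAt_eval x ω z)
  have h3 := DFunLike.congr_fun h2 (termField x θ ω z)
  rw [Term.lie, Term.eval_sum]
  simpa [termField] using h3

theorem polyField_toPoly (x : Fin ℓ ↪ V) (θ : Fin ℓ → Term V) (ω : V → ℝ)
    (h : ∀ i, (θ i).fv ⊆ range x) :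
    polyField (fun i => (θ i).toPoly x) = termField x θ ω := by
  funext a
  simp only [polyField, termField, Term.aeval_toPoly x ω (h _)]

theorem termField_congr {x : Fin ℓ ↪ V} {θ : Fin ℓ → Term V} {ω η : V → ℝ}
    (h : ∀ i, EqOn ω η ((θ i).fv \ range x)) : termField x θ ω = termField x θ η := by
  funext a
  simp only [termField]
  congr 1
  funext i
  refine Term.eval_congr fun v hv => ?_
  by_cases hx : ∃ j, x j = v
  · obtain ⟨j, rfl⟩ := hx
    simp only [x.injective.extend_apply]
  · rw [Function.extend_apply' _ _ _ hx, Function.extend_apply' _ _ _ hx]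
    exact h i ⟨hv, hx⟩

theorem eval_eq_termField {x : Fin ℓ ↪ V} {θ : Fin ℓ → Term V} {ω : V → ℝ} (i : Fin ℓ) :
    (θ i).eval ω = termField x θ ω (restr ω x) i := by
  simp only [termField, restr]
  refine Term.eval_congr fun v hv => ?_
  by_cases hx : ∃ j, x j = v
  · obtain ⟨j, rfl⟩ := hx
    simp only [x.injective.extend_apply]
  · rw [Function.extend_apply' _ _ _ hx]

end Terms

/-! ### Semantics of the first-order abbreviations -/

section FirstOrder

variable {V : Type u} {ℓ : ℕ}

namespace FOForm

open Classical in
theorem sat_le {s : V} {a b : Term V} {ω : V → ℝ}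
    (ha : ∀ c, a.eval (Function.update ω s c) = a.eval ω)
    (hb : ∀ c, b.eval (Function.update ω s c) = b.eval ω) :
    (le s a b).Sat ω ↔ a.eval ω ≤ b.eval ω := by
  simp only [le, Sat, Term.eval_add, Term.eval_mul, Term.eval_var, ha, hb, Function.update_self]
  refine ⟨fun ⟨c, hc⟩ => ?_, fun h => ⟨√(b.eval ω - a.eval ω), ?_⟩⟩
  · nlinarith [mul_self_nonneg c]
  · rw [Real.mul_self_sqrt (by linarith)]; ring

open Classical in
theorem sat_ballLe {n : ℕ} {s : V} {a : Fin n → Term V} {K : Term V} {ω : V → ℝ}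
    (ha : ∀ c i, (a i).eval (Function.update ω s c) = (a i).eval ω)
    (hK : ∀ c, K.eval (Function.update ω s c) = K.eval ω) :
    (ballLe s a K).Sat ω ↔
      (WithLp.toLp 2 fun i => (a i).eval ω : Pt n) ∈ bar n (K.eval ω) := by
  simp only [ballLe, Sat]
  rw [sat_le (by simp) hK, sat_le (by simp [Term.eval_sqNorm, ha]) (by simp [hK]),
    Term.eval_sqNorm, mem_closedBall_zero_iff]
  simp only [Term.eval_zero, Term.eval_mul]
  constructor
  · rintro ⟨h0, h1⟩
    exact abs_le_of_sq_le_sq' (by nlinarith) h0 |>.2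
  · intro h
    have := norm_nonneg (WithLp.toLp 2 fun i => (a i).eval ω : Pt n)
    exact ⟨this.trans h, by nlinarith⟩

open Classical in
theorem sat_exs (l : List V) (φ : FOForm V) (ω : V → ℝ) :
    (exs l φ).Sat ω ↔ ∃ η, EqOn ω η {v | v ∉ l} ∧ φ.Sat η := by
  induction l generalizing ω with
  | nil =>
    refine ⟨fun h => ⟨ω, fun _ _ => rfl, h⟩, fun ⟨η, h, h'⟩ => ?_⟩
    obtain rfl : ω = η := funext fun v => h (by simp)
    exact h'
  | cons x l ih =>
    change (∃ c, (exs l φ).Sat (Function.update ω x c)) ↔ _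
    simp only [ih]
    constructor
    · rintro ⟨c, η, h, h'⟩
      refine ⟨η, fun v hv => ?_, h'⟩
      simp only [List.mem_cons, not_or, mem_ofPred_eq] at hv
      rw [← h hv.2, Function.update_of_ne hv.1]
    · rintro ⟨η, h, h'⟩
      refine ⟨η x, η, fun v hv => ?_, h'⟩
      by_cases hx : v = x
      · subst hx; simp
      · rw [Function.update_of_ne hx]; exact h (by simp [hx]; exact hv)

end FOForm

end FirstOrder

/-! ### The Taylor bound formula -/

section Taylor

variable {V : Type u} {ℓ : ℕ} {r : Role ℓ ↪ V} {θ : Fin ℓ → Term V}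

/-- The only role variables occurring in `θ` are the space variables. -/
def OnlyX (r : Role ℓ ↪ V) (θ : Fin ℓ → Term V) : Prop :=
  ∀ i, ∀ ρ : Role ℓ, r ρ ∈ (θ i).fv → ∃ j, ρ = Role.x j

/-- The values of `x̄` are overwritten by the argument of the field and no other role variable
occurs in `θ`. The field therefore survives all state changes made by the reachability formulas. -/
theorem OnlyX.termField_eq (hθ : OnlyX r θ) {ω η : V → ℝ} (h : EqOn ω η (range r)ᶜ) :
    termField (xs r) θ ω = termField (xs r) θ η := by
  refine termField_congr fun i v hv => h ?_
  rintro ⟨ρ, rfl⟩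
  obtain ⟨j, rfl⟩ := hθ i ρ hv.1
  exact hv.2 ⟨j, rfl⟩

theorem eval_lieAtZ (ω : V → ℝ) (i : Fin ℓ) :
    (lieAtZ r θ i).eval ω =
      fderiv ℝ (termField (xs r) θ ω) (restr ω (zs r))
        (termField (xs r) θ ω (restr ω (zs r))) i := by
  rw [lieAtZ, Term.eval_subst, fderiv_termField]
  congr 1
  funext v
  by_cases hx : ∃ j, xs r j = v
  · obtain ⟨j, rfl⟩ := hx
    simp only [(xs r).injective.extend_apply, restr, Term.eval_var]
  · simp only [Function.extend_apply' _ _ _ hx, Term.eval_var]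

open Classical in
theorem update_role (ω : V → ℝ) {ρ σ : Role ℓ} (h : σ ≠ ρ) (c : ℝ) :
    Function.update ω (r ρ) c (r σ) = ω (r σ) :=
  Function.update_of_ne (r.injective.ne h) _ _

theorem OnlyX.sat_taylorForm (hθ : OnlyX r θ) (ω : V → ℝ) :
    (taylorForm r θ).Sat ω ↔
      (restr ω (xs r), restr ω (ys r), ω (r .t)) ∈
        taylorSet (termField (xs r) θ ω) (ω (r .K)) := by
  classical
  have hup : ∀ (ω : V → ℝ) (c : ℝ),
      termField (xs r) θ (Function.update ω (r .s) c) = termField (xs r) θ ω := fun ω c =>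
    hθ.termField_eq fun v hv => Function.update_of_ne (fun h => hv ⟨_, h.symm⟩) _ _
  have hx : ∀ (ω : V → ℝ) (c : ℝ) i, Function.update ω (r .s) c (xs r i) = ω (xs r i) :=
    fun ω c i => update_role ω (by simp) c
  have hy : ∀ (ω : V → ℝ) (c : ℝ) i, Function.update ω (r .s) c (ys r i) = ω (ys r i) :=
    fun ω c i => update_role ω (by simp) c
  have hz : ∀ (ω : V → ℝ) (c : ℝ) i, Function.update ω (r .s) c (zs r i) = ω (zs r i) :=
    fun ω c i => update_role ω (by simp) c
  have ht : ∀ (ω : V → ℝ) (c : ℝ), Function.update ω (r .s) c (r .t) = ω (r .t) :=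
    fun ω c => update_role ω (by simp) c
  have hK : ∀ (ω : V → ℝ) (c : ℝ), Function.update ω (r .s) c (r .K) = ω (r .K) :=
    fun ω c => update_role ω (by simp) c
  have hθs : ∀ (ω : V → ℝ) (c : ℝ) i,
      (θ i).eval (Function.update ω (r .s) c) = (θ i).eval ω := fun ω c i => by
    rw [eval_eq_termField (x := xs r), eval_eq_termField (x := xs r) (ω := ω), hup]
    simp only [restr, hx]
  have hlie : ∀ (ω : V → ℝ) (c : ℝ) i,
      (lieAtZ r θ i).eval (Function.update ω (r .s) c) = (lieAtZ r θ i).eval ω := fun ω c i => by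
    simp only [eval_lieAtZ, hup, restr, hz]
  have hd : ∀ ω : V → ℝ,
      (WithLp.toLp 2 fun i => (Term.var (ys r i) - Term.var (xs r i) -
        Term.var (r .t) * θ i).eval ω : Pt ℓ) = restr ω (ys r) - restr ω (xs r) -
          ω (r .t) • termField (xs r) θ ω (restr ω (xs r)) := fun ω => by
    ext i
    simp [restr, eval_eq_termField (x := xs r)]
  have hl : ∀ ω : V → ℝ, (WithLp.toLp 2 fun i => (lieAtZ r θ i).eval ω : Pt ℓ) =
      fderiv ℝ (termField (xs r) θ ω) (restr ω (zs r))
        (termField (xs r) θ ω (restr ω (zs r))) := fun ω => by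
    ext i
    simp [eval_lieAtZ]
  have hF := contDiff_termField (xs r) θ ω
  have h1 : ∀ η : V → ℝ, EqOn ω η {v | v ∉ List.ofFn (zs r)} → ∀ ρ, (∀ i, ρ ≠ Role.z i) →
      η (r ρ) = ω (r ρ) := fun η h ρ hρ => by
    refine (h ?_).symm
    simp only [List.mem_ofFn, mem_ofPred_eq]
    rintro ⟨i, hi⟩
    exact hρ i (r.injective hi).symm
  have h2 : ∀ η : V → ℝ, EqOn ω η {v | v ∉ List.ofFn (zs r)} →
      termField (xs r) θ η = termField (xs r) θ ω := fun η h => by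
    refine hθ.termField_eq fun v hv => (h ?_).symm
    simp only [List.mem_ofFn, mem_ofPred_eq]
    rintro ⟨i, rfl⟩
    exact hv ⟨_, rfl⟩
  have hsat : (taylorForm r θ).Sat ω ↔ 0 ≤ ω (r .t) ∧ restr ω (xs r) ∈ bar ℓ (ω (r .K)) ∧
      restr ω (ys r) ∈ bar ℓ (ω (r .K)) ∧ ∃ η, EqOn ω η {v | v ∉ List.ofFn (zs r)} ∧
        restr η (zs r) ∈ bar ℓ (ω (r .K)) ∧
        4 * ‖restr ω (ys r) - restr ω (xs r) -
          ω (r .t) • termField (xs r) θ ω (restr ω (xs r))‖ ^ 2 ≤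
        (ω (r .t) * ω (r .t)) * (ω (r .t) * ω (r .t)) *
          ‖fderiv ℝ (termField (xs r) θ ω) (restr η (zs r))
            (termField (xs r) θ ω (restr η (zs r)))‖ ^ 2 := by
    rw [taylorForm]
    simp only [FOForm.Sat]
    rw [FOForm.sat_le (by simp) (by simp), FOForm.sat_ballLe (by simp [hx]) (by simp),
      FOForm.sat_ballLe (by simp [hy]) (by simp), FOForm.sat_exs]
    refine and_congr (by simp) (and_congr (by rfl) (and_congr (by rfl)
      (exists_congr fun η => and_congr_right fun h => ?_)))
    simp only [FOForm.Sat]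
    rw [FOForm.sat_ballLe (by simp [hz]) (by simp), FOForm.sat_le]
    · have e1 : restr η (xs r) = restr ω (xs r) := by
        ext i; exact h1 η h (.x i) (by simp)
      have e2 : restr η (ys r) = restr ω (ys r) := by
        ext i; exact h1 η h (.y i) (by simp)
      simp only [Term.eval_mul, Term.eval_var, Term.eval_const, Term.eval_sqNorm, hd, hl,
        h1 η h .t (by simp), h1 η h .K (by simp), h2 η h, e1, e2]
      rw [Rat.cast_ofNat]
      rfl
    · simp [Term.eval_sqNorm, hx, hy, hθs]
    · simp [Term.eval_sqNorm, hlie]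
  rw [hsat]
  simp only [taylorSet, mem_ofPred_eq]
  constructor
  · rintro ⟨ht0, hx0, hy0, η, -, hz0, hle⟩
    refine ⟨hx0, hy0, ht0, ?_⟩
    have hz1 := norm_fderiv_le_iSup hF hz0
    refine le_trans ?_ (mul_le_mul_of_nonneg_left hz1 (by positivity))
    -- The formula compares squares: divide by 4 and take roots, the right-hand side being
    -- nonnegative.
    refine abs_le_of_sq_le_sq' (a := ‖_‖) (le_trans ?_ (div_le_div_of_nonneg_right hle
      (c := 4) (by norm_num) |>.trans (le_of_eq ?_))) (by positivity) |>.2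
    · exact le_of_eq (by ring)
    · ring
  · rintro ⟨hx0, hy0, ht0, hle⟩
    refine ⟨ht0, hx0, hy0, ?_⟩
    -- The bound on `x̄` forces `K` to be nonnegative, so the ball is nonempty and a maximiser
    -- exists to serve as `z̄`.
    have hK0 : 0 ≤ ω (r .K) := (norm_nonneg _).trans (mem_closedBall_zero_iff.1 hx0)
    obtain ⟨z, hz0, hz1⟩ := exists_norm_fderiv_eq_iSup hF hK0
    have hzz : restr (Function.extend (zs r) (fun j => z j) ω) (zs r) = z := by
      ext i
      simp only [restr, (zs r).injective.extend_apply]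
    refine ⟨Function.extend (zs r) (fun j => z j) ω, fun v hv => ?_, ?_, ?_⟩
    · rw [Function.extend_apply']
      simpa using hv
    · rwa [hzz]
    · rw [hzz]
      rw [hz1] at hle
      have := pow_le_pow_left₀ (norm_nonneg _) hle 2
      calc _ ≤ 4 * _ := mul_le_mul_of_nonneg_left this (by norm_num)
        _ = _ := by ring

end Taylor

variable {V : Type u} {W : Type v}

/-! ### State updates shared by the two logics -/

section States

open Classical in
/-- The effect on a state of assigning `c` to `x` through the auxiliary variable `s`. -/
noncomputable def put (s x : V) (c : ℝ) (ω : V → ℝ) : V → ℝ :=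
  Function.update (Function.update ω s c) x c

/-- The effect on a state of a sequence of assignments through the auxiliary variable `s`. -/
noncomputable def putList (s : V) : List (V × V) → (V → ℝ) → V → ℝ
  | [], ω => ω
  | p :: l, ω => putList s l (put s p.1 (ω p.2) ω)

/-- The effect on a state of copying `y` to `x` through the auxiliary variable `s`. -/
noncomputable def copy {n : ℕ} (s : V) (x y : Fin n ↪ V) (ω : V → ℝ) : V → ℝ :=
  putList s (List.ofFn fun i => (x i, y i)) ω

theorem put_self (s x : V) (c : ℝ) (ω : V → ℝ) : put s x c ω x = c := by
  simp [put]

theorem put_of_ne {s x v : V} (hs : v ≠ s) (hx : v ≠ x) (c : ℝ) (ω : V → ℝ) :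
    put s x c ω v = ω v := by
  simp [put, hs, hx]

theorem putList_of_ne {s v : V} {l : List (V × V)} (hs : v ≠ s) (hl : ∀ p ∈ l, v ≠ p.1)
    (ω : V → ℝ) : putList s l ω v = ω v := by
  induction l generalizing ω with
  | nil => rfl
  | cons p l ih =>
    rw [putList, ih fun q hq => hl q (List.mem_cons_of_mem _ hq),
      put_of_ne hs (hl p List.mem_cons_self)]

/-- Executing the assignments one by one agrees with simultaneous assignment: distinct targets are
not overwritten later, and no source is a target or the auxiliary variable. -/
theorem putList_fst {s : V} {l : List (V × V)} (hl : (l.map Prod.fst).Nodup)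
    (h12 : ∀ p ∈ l, ∀ q ∈ l, p.1 ≠ q.2) (h1 : ∀ p ∈ l, p.1 ≠ s) (h2 : ∀ p ∈ l, p.2 ≠ s)
    {p : V × V} (hp : p ∈ l) (ω : V → ℝ) : putList s l ω p.1 = ω p.2 := by
  induction l generalizing ω with
  | nil => cases hp
  | cons q l ih =>
    simp only [List.map_cons, List.nodup_cons, List.mem_map, not_exists, not_and] at hl
    rw [putList]
    rcases List.mem_cons.1 hp with rfl | hp'
    · rw [putList_of_ne (h1 _ hp) fun r hr h => hl.1 r hr h.symm, put_self]
    · rw [ih hl.2 (fun a ha b hb => h12 a (List.mem_cons_of_mem _ ha) b (List.mem_cons_of_mem _ hb))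
        (fun a ha => h1 a (List.mem_cons_of_mem _ ha))
        (fun a ha => h2 a (List.mem_cons_of_mem _ ha)) hp',
        put_of_ne (h2 p hp) (h12 q List.mem_cons_self p hp).symm]

theorem copy_of_ne {n : ℕ} {s v : V} {x y : Fin n ↪ V} (hs : v ≠ s) (hx : ∀ i, v ≠ x i)
    (ω : V → ℝ) : copy s x y ω v = ω v :=
  putList_of_ne hs (by simpa [List.mem_ofFn] using hx) ω

theorem copy_apply {n : ℕ} {s : V} {x y : Fin n ↪ V} (hx : ∀ i, x i ≠ s) (hy : ∀ i, y i ≠ s)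
    (hxy : ∀ i j, x i ≠ y j) (ω : V → ℝ) (i : Fin n) : copy s x y ω (x i) = ω (y i) := by
  refine putList_fst (p := (x i, y i)) ?_ ?_ ?_ ?_ ?_ ω
  · rw [List.map_ofFn]
    exact List.nodup_ofFn.2 x.injective
  · simpa [List.mem_ofFn] using hxy
  · simpa [List.mem_ofFn] using hx
  · simpa [List.mem_ofFn] using hy
  · simp [List.mem_ofFn]

open Classical in
theorem exists_update_eqOn_iff {x : V} {l : List V} {S : Set (V → ℝ)} {ω : V → ℝ} :
    (∃ c, ∃ η, EqOn (Function.update ω x c) η {v | v ∉ l} ∧ η ∈ S) ↔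
      ∃ η, EqOn ω η {v | v ∉ x :: l} ∧ η ∈ S := by
  constructor
  · rintro ⟨c, η, h, h'⟩
    refine ⟨η, fun v hv => ?_, h'⟩
    simp only [List.mem_cons, not_or, mem_ofPred_eq] at hv
    rw [← h hv.2, Function.update_of_ne hv.1]
  · rintro ⟨η, h, h'⟩
    refine ⟨η x, η, fun v hv => ?_, h'⟩
    by_cases hx : v = x
    · subst hx; simp
    · rw [Function.update_of_ne hx]; exact h (by simp [hx]; exact hv)

theorem exists_eqOn_nil_iff {S : Set (V → ℝ)} {ω : V → ℝ} :
    (∃ η, EqOn ω η {v | v ∉ ([] : List V)} ∧ η ∈ S) ↔ ω ∈ S := by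
  refine ⟨fun ⟨η, h, h'⟩ => ?_, fun h => ⟨ω, fun _ _ => rfl, h⟩⟩
  obtain rfl : ω = η := funext fun v => h (by simp)
  exact h'

open Classical in
theorem mem_atomWin_star {x : V} {S : Set (V → ℝ)} {ω : V → ℝ} :
    ω ∈ atomWin .star (single x) Fin.elim0 S ↔ ∃ c, Function.update ω x c ∈ S := by
  have h : ∀ b : Fin 1 → ℝ, Function.extend (single x) b ω = Function.update ω x (b 0) := by
    intro b
    funext v
    by_cases hv : v = x
    · subst hv
      rw [Function.update_self]
      exact (single v).injective.extend_apply b ω 0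
    · rw [Function.update_of_ne hv, Function.extend_apply']
      rintro ⟨_, h⟩
      exact hv h.symm
  constructor
  · rintro ⟨E, ⟨b, hb⟩, hE⟩
    exact ⟨b 0, h b ▸ hE b hb⟩
  · rintro ⟨c, hc⟩
    refine ⟨{fun _ => c}, ⟨_, rfl⟩, ?_⟩
    rintro b rfl
    rwa [h]

theorem mem_atomWin_dyn {ℓ : ℕ} {F : Fin ℓ → MvPolynomial (Fin ℓ) ℚ} {x : Fin ℓ ↪ V}
    {S : Set (V → ℝ)} {ω : V → ℝ} :
    ω ∈ atomWin (.dyn F) x (fun i => .var (x i)) S ↔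
      ∃ t, ∃ b : Pt ℓ, ReachIn (polyField F) univ t (restr ω x) b ∧
        Function.extend x (fun i => b i) ω ∈ S := by
  constructor
  · rintro ⟨E, ⟨b, hb, t, -, h⟩, hE⟩
    exact ⟨t, _, h, hE b hb⟩
  · rintro ⟨t, b, h, hS⟩
    refine ⟨{fun i => b i}, ⟨_, rfl, t, h.1, h⟩, ?_⟩
    rintro _ rfl
    exact hS

theorem atomWin_mono {k l : ℕ} {a : Act k l} {x : Fin k ↪ V} {θ : Fin l → Term V}
    {S T : Set (V → ℝ)} (h : S ⊆ T) : atomWin a x θ S ⊆ atomWin a x θ T :=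
  fun _ ⟨E, hE, hS⟩ => ⟨E, hE, fun b hb => h (hS b hb)⟩

open Classical in
-- Since `a` does not read `s`, both choices are forced. As a side effect `s` keeps the assigned
-- value.
theorem exists_assign_iff {s x : V} (hx : x ≠ s) {a : Term V} {ω : V → ℝ} {S : Set (V → ℝ)}
    (ha : ∀ c, a.eval (Function.update ω s c) = a.eval ω) :
    (∃ c, c = a.eval (Function.update ω s c) ∧ ∃ d, d = Function.update
        (Function.update ω s c) x d s ∧ Function.update (Function.update ω s c) x d ∈ S) ↔
      put s x (a.eval ω) ω ∈ S := by
  simp [ha, put, Function.update_of_ne hx.symm]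

end States

/-! ### Semantics of the `μ`-calculus abbreviations -/

namespace MuForm

variable {I : W → Set (V → ℝ)} {φ : MuForm V W}

open Classical in
theorem mem_sem_ex {x : V} {ω : V → ℝ} :
    ω ∈ (ex x φ).sem I ↔ ∃ c, Function.update ω x c ∈ φ.sem I := mem_atomWin_star

theorem mem_sem_exs {l : List V} {ω : V → ℝ} :
    ω ∈ (exs l φ).sem I ↔ ∃ η, EqOn ω η {v | v ∉ l} ∧ η ∈ φ.sem I := by
  induction l generalizing ω with
  | nil => exact exists_eqOn_nil_iff.symm
  | cons x l ih =>
    change ω ∈ (ex x (exs l φ)).sem I ↔ _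
    simp only [mem_sem_ex, ih]
    exact exists_update_eqOn_iff

open Classical in
theorem mem_sem_assign {s x : V} (hx : x ≠ s) {a : Term V} {ω : V → ℝ}
    (ha : ∀ c, a.eval (Function.update ω s c) = a.eval ω) :
    ω ∈ (assign s x a φ).sem I ↔ put s x (a.eval ω) ω ∈ φ.sem I := by
  rw [← exists_assign_iff hx ha, assign]
  simp only [mem_sem_ex, sem, mem_inter_iff, mem_ofPred_eq, Term.eval_var, Function.update_self]

open Classical in
theorem mem_sem_assigns {n : ℕ} {s : V} {x y : Fin n ↪ V} (hx : ∀ i, x i ≠ s)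
    (hy : ∀ i, y i ≠ s) {ω : V → ℝ} :
    ω ∈ (assigns s x y φ).sem I ↔ copy s x y ω ∈ φ.sem I := by
  have h : ∀ l : List (V × V), (∀ p ∈ l, p.1 ≠ s ∧ p.2 ≠ s) → ∀ ω,
      ω ∈ (l.foldr (fun p ψ => assign s p.1 (.var p.2) ψ) φ).sem I ↔
        putList s l ω ∈ φ.sem I := by
    intro l hl
    induction l with
    | nil => exact fun ω => Iff.rfl
    | cons p l ih =>
      intro ω
      have hp := hl p List.mem_cons_self
      rw [List.foldr_cons, mem_sem_assign (a := .var p.2) hp.1 fun c => Function.update_of_ne hp.2 _ _,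
        ih fun q hq => hl q (List.mem_cons_of_mem _ hq)]
      rfl
  refine h _ ?_ ω
  simpa [List.mem_ofFn] using fun i => ⟨hx i, hy i⟩

theorem mem_sem_toMu {φ : FOForm V} {ω : V → ℝ} : ω ∈ (φ.toMu W).sem I ↔ φ.Sat ω := by
  induction φ generalizing ω with
  | eq a b => rfl
  | neg φ ih => exact not_congr ih
  | and φ ψ h1 h2 => exact and_congr h1 h2
  | ex x φ ih =>
    rw [FOForm.toMu, mem_sem_ex]
    exact exists_congr fun c => ih

theorem mem_sem_iff {φ ψ : MuForm V W} {ω : V → ℝ} :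
    ω ∈ (iff φ ψ).sem I ↔ (ω ∈ φ.sem I ↔ ω ∈ ψ.sem I) := by
  simp only [iff, sem, mem_inter_iff, mem_compl_iff]
  tauto

open Classical in
theorem sem_substFix {X : W} (φ : MuForm V W) (I : W → Set (V → ℝ)) :
    (substFix X (neg (fix X)) φ).sem I = φ.sem (Function.update I X (I X)ᶜ) := by
  induction φ generalizing I with
  | fix Y =>
    by_cases h : Y = X
    · subst h; simp [substFix, sem]
    · simp [substFix, sem, h]
  | eq a b => rfl
  | neg φ ih => simp only [substFix, sem, ih]
  | and φ ψ h1 h2 => simp only [substFix, sem, h1, h2]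
  | dia a x θ φ ih => simp only [substFix, sem, ih]
  | mu Y φ ih =>
    by_cases h : Y = X
    · subst h; simp [substFix, sem]
    · simp only [substFix, if_neg h, sem, ih]
      congr! 4 with Z
      rw [Function.update_of_ne (Ne.symm h), Function.update_comm h]

-- Complements of prefixed sets of the dual operator are the postfixed sets of `φ`. This description
-- of `ν` as a union needs no monotonicity.
open Classical in
theorem mem_sem_nu {X : W} {ω : V → ℝ} :
    ω ∈ (nu X φ).sem I ↔ ∃ Z, Z ⊆ φ.sem (Function.update I X Z) ∧ ω ∈ Z := by
  simp only [nu, sem, mem_compl_iff, mem_sInter, mem_ofPred_eq, sem_substFix,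
    Function.update_self, Function.update_idem]
  push Not
  constructor
  · rintro ⟨Z, h, hω⟩
    exact ⟨Zᶜ, compl_subset_comm.1 h, hω⟩
  · rintro ⟨Z, h, hω⟩
    exact ⟨Zᶜ, by rw [compl_compl]; exact compl_subset_compl.2 h, fun h' => h' hω⟩

end MuForm

/-! ### Semantics of the game logic abbreviations -/

namespace Dgl

open Classical in
theorem mem_sem_havoc {x : V} {S : Set (V → ℝ)} {ω : V → ℝ} :
    ω ∈ (havoc x).sem S ↔ ∃ c, Function.update ω x c ∈ S := mem_atomWin_star

open Classical in
theorem mem_sem_ex {x : V} {φ : Dgl V .form} {ω : V → ℝ} :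
    ω ∈ (ex x φ).sem ↔ ∃ c, Function.update ω x c ∈ φ.sem := mem_sem_havoc

open Classical in
theorem mem_sem_exs {l : List V} {φ : Dgl V .form} {ω : V → ℝ} :
    ω ∈ (exs l φ).sem ↔ ∃ η, EqOn ω η {v | v ∉ l} ∧ η ∈ φ.sem := by
  induction l generalizing ω with
  | nil => exact exists_eqOn_nil_iff.symm
  | cons x l ih =>
    exact (mem_sem_ex.trans (exists_congr fun c => ih)).trans exists_update_eqOn_iff

theorem sem_skip (S : Set (V → ℝ)) : (skip : Dgl V .game).sem S = S := by
  simp [skip, sem]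

open Classical in
theorem mem_sem_seqs_havoc {n : ℕ} {x : Fin n ↪ V} {S : Set (V → ℝ)} {ω : V → ℝ} :
    ω ∈ (seqs (List.ofFn fun i => havoc (x i))).sem S ↔
      ∃ η, EqOn ω η (range x)ᶜ ∧ η ∈ S := by
  have h : ∀ (l : List V) (ω : V → ℝ), ω ∈ (seqs (l.map havoc)).sem S ↔
      ∃ η, EqOn ω η {v | v ∉ l} ∧ η ∈ S := by
    intro l
    induction l with
    | nil =>
      intro ω
      rw [exists_eqOn_nil_iff]
      change ω ∈ skip.sem S ↔ _
      rw [sem_skip]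
    | cons y l ih =>
      intro ω
      change ω ∈ (havoc y).sem ((seqs (l.map havoc)).sem S) ↔ _
      simp only [mem_sem_havoc, ih]
      exact exists_update_eqOn_iff
  have e : (List.ofFn fun i => havoc (x i)) = (List.ofFn x).map havoc := by
    rw [List.map_ofFn]; rfl
  rw [e, h]
  have e' : {v | v ∉ List.ofFn x} = (range x)ᶜ := by
    ext v; simp [List.mem_ofFn]
  rw [e']

open Classical in
theorem mem_sem_assign {s x : V} (hx : x ≠ s) {a : Term V} {ω : V → ℝ}
    (ha : ∀ c, a.eval (Function.update ω s c) = a.eval ω) {S : Set (V → ℝ)} :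
    ω ∈ (assign s x a).sem S ↔ put s x (a.eval ω) ω ∈ S := by
  rw [← exists_assign_iff hx ha, assign]
  change ω ∈ (havoc s).sem ({ω | ω s = a.eval ω} ∩
    (havoc x).sem ({ω | ω x = ω s} ∩ S)) ↔ _
  simp only [mem_sem_havoc, mem_inter_iff, mem_ofPred_eq, Function.update_self]

open Classical in
theorem mem_sem_assigns {n : ℕ} {s : V} {x y : Fin n ↪ V} (hx : ∀ i, x i ≠ s)
    (hy : ∀ i, y i ≠ s) {S : Set (V → ℝ)} {ω : V → ℝ} :
    ω ∈ (assigns s x y).sem S ↔ copy s x y ω ∈ S := by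
  have h : ∀ l : List (V × V), (∀ p ∈ l, p.1 ≠ s ∧ p.2 ≠ s) → ∀ ω,
      ω ∈ (seqs (l.map fun p => assign s p.1 (.var p.2))).sem S ↔ putList s l ω ∈ S := by
    intro l hl
    induction l with
    | nil =>
      intro ω
      change ω ∈ skip.sem S ↔ _
      rw [sem_skip]; rfl
    | cons p l ih =>
      intro ω
      have hp := hl p List.mem_cons_self
      exact (mem_sem_assign (a := .var p.2) (ω := ω) hp.1
        fun c => Function.update_of_ne hp.2 _ _).trans
          (ih (fun q hq => hl q (List.mem_cons_of_mem _ hq)) _)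
  have e : (List.ofFn fun i => assign s (x i) (.var (y i))) =
      (List.ofFn fun i => (x i, y i)).map fun p => assign s p.1 (.var p.2) := by
    rw [List.map_ofFn]; rfl
  rw [assigns, e]
  refine h _ ?_ ω
  simpa [List.mem_ofFn] using fun i => ⟨hx i, hy i⟩

open Classical in
theorem mem_sem_toDgl {φ : FOForm V} {ω : V → ℝ} : ω ∈ φ.toDgl.sem ↔ φ.Sat ω := by
  induction φ generalizing ω with
  | eq a b => rfl
  | neg φ ih => exact not_congr ih
  | and φ ψ h1 h2 => exact and_congr h1 h2
  | ex x φ ih =>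
    rw [FOForm.toDgl, mem_sem_ex]
    exact exists_congr fun c => ih

theorem mem_sem_iff {φ ψ : Dgl V .form} {ω : V → ℝ} :
    ω ∈ (iff φ ψ).sem ↔ (ω ∈ φ.sem ↔ ω ∈ ψ.sem) := by
  simp only [iff, sem, mem_inter_iff, mem_compl_iff]
  tauto

/-- The least fixpoint for `rep` complements to a union of invariants: sets inside the goal that the
dual game can preserve for one more round. This matches the form of `MuForm.mem_sem_nu`. -/
theorem mem_sem_box_rep {α : Dgl V .game} {φ : Dgl V .form} {ω : V → ℝ} :
    ω ∈ (box (rep α) φ).sem ↔ ∃ Z, Z ⊆ φ.sem ∩ (α.sem Zᶜ)ᶜ ∧ ω ∈ Z := by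
  simp only [box, sem, mem_compl_iff, mem_sInter, mem_ofPred_eq]
  push Not
  constructor
  · rintro ⟨Z, h, hω⟩
    refine ⟨Zᶜ, fun η hη => ⟨?_, ?_⟩, hω⟩
    · by_contra h'
      exact hη (h (Or.inl h'))
    · intro h'
      rw [compl_compl] at h'
      exact hη (h (Or.inr h'))
  · rintro ⟨Z, h, hω⟩
    refine ⟨Zᶜ, ?_, fun h' => h' hω⟩
    rintro η (hη | hη) hη'
    · exact hη (h hη').1
    · exact (h hη').2 hη

end Dgl

variable {V : Type u} {W : Type v} {ℓ : ℕ} {r : Role ℓ ↪ V} {θ : Fin ℓ → Term V}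

/-! ### Both formulas define bounded reachability -/

section Reachability

/-- The states in which `ȳ` is `t`-reachable from `x̄` within the ball of radius `K`. -/
def reachSet (r : Role ℓ ↪ V) (θ : Fin ℓ → Term V) : Set (V → ℝ) :=
  {ω | ReachIn (termField (xs r) θ ω) (bar ℓ (ω (r .K))) (ω (r .t))
    (restr ω (xs r)) (restr ω (ys r))}

/-- `ζ` arises from `η` by halving `t` and changing `ū` and the auxiliary variable. -/
def HalfStep (r : Role ℓ ↪ V) (η ζ : V → ℝ) : Prop :=
  EqOn η ζ ({r .t, r .s} ∪ range (us r))ᶜ ∧ ζ (r .t) = η (r .t) / 2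

theorem HalfStep.role {η ζ : V → ℝ} (h : HalfStep r η ζ) {ρ : Role ℓ} (ht : ρ ≠ .t)
    (hs : ρ ≠ .s) (hu : ∀ i, ρ ≠ .u i) : ζ (r ρ) = η (r ρ) := by
  refine (h.1 ?_).symm
  rintro ((h | h) | ⟨i, h⟩)
  · exact ht (r.injective h)
  · exact hs (r.injective h)
  · exact hu i (r.injective h).symm

theorem HalfStep.outside {η ζ : V → ℝ} (h : HalfStep r η ζ) : EqOn η ζ (range r)ᶜ := by
  refine h.1.mono (compl_subset_compl.2 ?_)
  rintro v ((rfl | rfl) | ⟨i, rfl⟩) <;> exact ⟨_, rfl⟩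

theorem copy_role {x y : Fin ℓ ↪ V} {ρ : Role ℓ} (hs : ρ ≠ .s) (hx : ∀ i, r ρ ≠ x i)
    (ω : V → ℝ) : copy (r .s) x y ω (r ρ) = ω (r ρ) :=
  copy_of_ne (r.injective.ne hs) hx ω

theorem copy_outside {x y : Fin ℓ ↪ V} (hx : range x ⊆ range r) (ω : V → ℝ) :
    EqOn (copy (r .s) x y ω) ω (range r)ᶜ := fun _ hv =>
  copy_of_ne (fun h => hv ⟨_, h.symm⟩) (fun i h => hv (hx ⟨i, h.symm⟩)) ω

theorem xs_ne {ρ : Role ℓ} (h : ∀ i, ρ ≠ .x i) (i : Fin ℓ) : r ρ ≠ xs r i :=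
  fun e => h i (r.injective e)

theorem ys_ne {ρ : Role ℓ} (h : ∀ i, ρ ≠ .y i) (i : Fin ℓ) : r ρ ≠ ys r i :=
  fun e => h i (r.injective e)

theorem us_ne {ρ : Role ℓ} (h : ∀ i, ρ ≠ .u i) (i : Fin ℓ) : r ρ ≠ us r i :=
  fun e => h i (r.injective e)

theorem xs_subset : range (xs r) ⊆ range r := by rintro _ ⟨i, rfl⟩; exact ⟨_, rfl⟩

theorem ys_subset : range (ys r) ⊆ range r := by rintro _ ⟨i, rfl⟩; exact ⟨_, rfl⟩

theorem restr_copy_xs (ω : V → ℝ) :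
    restr (copy (r .s) (xs r) (us r) ω) (xs r) = restr ω (us r) := by
  ext i
  exact copy_apply (fun i => (xs_ne (by simp) i).symm) (fun i => (us_ne (by simp) i).symm)
    (fun i j => us_ne (ρ := .x i) (by simp) j) ω i

theorem restr_copy_ys (ω : V → ℝ) :
    restr (copy (r .s) (ys r) (us r) ω) (ys r) = restr ω (us r) := by
  ext i
  exact copy_apply (fun i => (ys_ne (by simp) i).symm) (fun i => (us_ne (by simp) i).symm)
    (fun i j => us_ne (ρ := .y i) (by simp) j) ω i

theorem restr_copy_xs_ys (ω : V → ℝ) :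
    restr (copy (r .s) (xs r) (us r) ω) (ys r) = restr ω (ys r) := by
  ext i
  exact copy_role (ρ := .y i) (by simp) (xs_ne (by simp)) ω

theorem restr_copy_ys_xs (ω : V → ℝ) :
    restr (copy (r .s) (ys r) (us r) ω) (xs r) = restr ω (xs r) := by
  ext i
  exact copy_role (ρ := .x i) (by simp) (ys_ne (by simp)) ω

theorem HalfStep.restr_xs {η ζ : V → ℝ} (h : HalfStep r η ζ) :
    restr ζ (xs r) = restr η (xs r) := by
  ext i
  exact h.role (ρ := .x i) (by simp) (by simp) (by simp)

theorem HalfStep.restr_ys {η ζ : V → ℝ} (h : HalfStep r η ζ) :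
    restr ζ (ys r) = restr η (ys r) := by
  ext i
  exact h.role (ρ := .y i) (by simp) (by simp) (by simp)

/-- A set of states satisfying the Taylor bound, with midpoints, consists of reachable pairs. -/
theorem OnlyX.subset_reachSet (hθ : OnlyX r θ) {Z : Set (V → ℝ)}
    (hG : ∀ η ∈ Z, (taylorForm r θ).Sat η)
    (hZ : ∀ η ∈ Z, ∃ ζ, HalfStep r η ζ ∧ copy (r .s) (xs r) (us r) ζ ∈ Z ∧
      copy (r .s) (ys r) (us r) ζ ∈ Z) : Z ⊆ reachSet r θ := by
  intro ω hω
  -- Only states with the parameters and the `K` of `ω` are collected, so one field and one ball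
  -- serve the entire relation. The values of `ū`, `z̄` and `s` are left free.
  let R : Pt ℓ → Pt ℓ → ℝ → Prop := fun a b t => ∃ η ∈ Z, EqOn η ω (range r)ᶜ ∧
    η (r .K) = ω (r .K) ∧ restr η (xs r) = a ∧ restr η (ys r) = b ∧ η (r .t) = t
  refine reachIn_of_midpoints (contDiff_termField _ _ _) (R := R) ?_ ?_
    ⟨ω, hω, fun _ _ => rfl, rfl, rfl, rfl, rfl⟩
  · rintro _ _ _ ⟨η, hη, h1, h2, rfl, rfl, rfl⟩
    rw [← hθ.termField_eq h1, ← h2]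
    exact (hθ.sat_taylorForm η).1 (hG η hη)
  · rintro _ _ _ ⟨η, hη, h1, h2, rfl, rfl, rfl⟩
    obtain ⟨ζ, hζ, hx, hy⟩ := hZ η hη
    have hK : ζ (r .K) = ω (r .K) := (hζ.role (by simp) (by simp) (by simp)).trans h2
    -- Copying `ū` to `ȳ` yields the first half of the path, copying it to `x̄` the second.
    refine ⟨restr ζ (us r), ⟨_, hy, ?_, ?_, ?_, restr_copy_ys ζ, ?_⟩,
      ⟨_, hx, ?_, ?_, restr_copy_xs ζ, ?_, ?_⟩⟩
    · exact (copy_outside ys_subset ζ).trans (hζ.outside.symm.trans h1)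
    · rw [copy_role (by simp) (ys_ne (by simp)), hK]
    · rw [restr_copy_ys_xs, hζ.restr_xs]
    · rw [copy_role (by simp) (ys_ne (by simp)), hζ.2]
    · exact (copy_outside xs_subset ζ).trans (hζ.outside.symm.trans h1)
    · rw [copy_role (by simp) (xs_ne (by simp)), hK]
    · rw [restr_copy_xs_ys, hζ.restr_ys]
    · rw [copy_role (by simp) (xs_ne (by simp)), hζ.2]

theorem OnlyX.sat_of_mem_reachSet (hθ : OnlyX r θ) {ω : V → ℝ} (h : ω ∈ reachSet r θ) :
    (taylorForm r θ).Sat ω :=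
  (hθ.sat_taylorForm ω).2 (ReachIn.mem_taylorSet (contDiff_termField _ _ _) h)

/-- The point at half time works for every `ζ`, because reachability ignores `s`. This generality
covers both formulas, one choosing `ū` before halving `t` and the other after. -/
theorem OnlyX.exists_midpoint (hθ : OnlyX r θ) {ω : V → ℝ} (h : ω ∈ reachSet r θ) :
    ∃ m : Pt ℓ, ∀ ζ, HalfStep r ω ζ → restr ζ (us r) = m →
      copy (r .s) (xs r) (us r) ζ ∈ reachSet r θ ∧
        copy (r .s) (ys r) (us r) ζ ∈ reachSet r θ := by
  have h0 : 0 ≤ ω (r .t) := h.1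
  have h' : ReachIn (termField (xs r) θ ω) (bar ℓ (ω (r .K))) (ω (r .t) / 2 + ω (r .t) / 2)
      (restr ω (xs r)) (restr ω (ys r)) := by rwa [add_halves]
  obtain ⟨m, h1, h2⟩ := h'.exists_split (by linarith) (by linarith)
  refine ⟨m, fun ζ hζ hm => ⟨?_, ?_⟩⟩
  · rw [reachSet, mem_ofPred_eq, hθ.termField_eq ((copy_outside xs_subset ζ).trans
      hζ.outside.symm), restr_copy_xs, restr_copy_xs_ys, hζ.restr_ys, hm,
      copy_role (by simp) (xs_ne (by simp)), copy_role (by simp) (xs_ne (by simp)), hζ.2,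
      hζ.role (by simp) (by simp) (by simp)]
    exact h2
  · rw [reachSet, mem_ofPred_eq, hθ.termField_eq ((copy_outside ys_subset ζ).trans
      hζ.outside.symm), restr_copy_ys, restr_copy_ys_xs, hζ.restr_xs, hm,
      copy_role (by simp) (ys_ne (by simp)), copy_role (by simp) (ys_ne (by simp)), hζ.2,
      hζ.role (by simp) (by simp) (by simp)]
    exact h1

theorem eval_halfT (ω : V → ℝ) : (halfT r).eval ω = ω (r .t) / 2 := by
  simp only [halfT, Term.eval_mul, Term.eval_const, Term.eval_var]
  push_cast
  ring

open Classical in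
theorem eval_halfT_update (ω : V → ℝ) (c : ℝ) :
    (halfT r).eval (Function.update ω (r .s) c) = (halfT r).eval ω := by
  rw [eval_halfT, eval_halfT, update_role _ (by simp)]

theorem halfStep_put_of_eqOn {ω η : V → ℝ} (h : EqOn ω η (range (us r))ᶜ) :
    HalfStep r ω (put (r .s) (r .t) (η (r .t) / 2) η) := by
  refine ⟨fun v hv => ?_, ?_⟩
  · simp only [mem_compl_iff, mem_union, mem_insert_iff, mem_singleton_iff, not_or] at hv
    rw [put_of_ne hv.1.2 hv.1.1]
    exact h hv.2
  · rw [put_self, h]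
    rintro ⟨i, hi⟩
    exact us_ne (ρ := .t) (by simp) i hi.symm

theorem halfStep_of_eqOn_put {ω η : V → ℝ}
    (h : EqOn (put (r .s) (r .t) (ω (r .t) / 2) ω) η (range (us r))ᶜ) : HalfStep r ω η := by
  refine ⟨fun v hv => ?_, ?_⟩
  · simp only [mem_compl_iff, mem_union, mem_insert_iff, mem_singleton_iff, not_or] at hv
    rw [← h hv.2, put_of_ne hv.1.2 hv.1.1]
  · rw [← h, put_self]
    rintro ⟨i, hi⟩
    exact us_ne (ρ := .t) (by simp) i hi.symm

theorem exists_eqOn_restr {n : ℕ} (x : Fin n ↪ V) (ω : V → ℝ) (a : Pt n) :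
    ∃ η, EqOn ω η (range x)ᶜ ∧ restr η x = a := by
  refine ⟨Function.extend x (fun i => a i) ω, fun v hv => ?_, ?_⟩
  · rw [Function.extend_apply' _ _ _ hv]
  · ext i
    simp only [restr, x.injective.extend_apply]

theorem setOf_notMem_ofFn {n : ℕ} (x : Fin n ↪ V) : {v | v ∉ List.ofFn x} = (range x)ᶜ := by
  ext v; simp [List.mem_ofFn]

open Classical in
theorem OnlyX.sem_reachMu (hθ : OnlyX r θ) (X : W) (I : W → Set (V → ℝ)) :
    (reachMu r X θ).sem I = reachSet r θ := by
  ext ω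
  have hb : ∀ (Z : Set (V → ℝ)) (η : V → ℝ), η ∈ (MuForm.and ((taylorForm r θ).toMu W) <|
      .exs (List.ofFn (us r)) <| .assign (r .s) (r .t) (halfT r) <|
      .and (.assigns (r .s) (xs r) (us r) (.fix X))
        (.assigns (r .s) (ys r) (us r) (.fix X))).sem (Function.update I X Z) ↔
      (taylorForm r θ).Sat η ∧ ∃ ζ, EqOn η ζ (range (us r))ᶜ ∧
        copy (r .s) (xs r) (us r) (put (r .s) (r .t) (ζ (r .t) / 2) ζ) ∈ Z ∧
        copy (r .s) (ys r) (us r) (put (r .s) (r .t) (ζ (r .t) / 2) ζ) ∈ Z := by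
    intro Z η
    rw [MuForm.sem, mem_inter_iff, MuForm.mem_sem_toMu, MuForm.mem_sem_exs, setOf_notMem_ofFn]
    refine and_congr_right fun _ => exists_congr fun ζ => and_congr_right fun _ => ?_
    rw [MuForm.mem_sem_assign (r.injective.ne (by simp)) (eval_halfT_update ζ), eval_halfT,
      MuForm.sem, mem_inter_iff,
      MuForm.mem_sem_assigns (fun i => (xs_ne (by simp) i).symm)
        (fun i => (us_ne (by simp) i).symm),
      MuForm.mem_sem_assigns (fun i => (ys_ne (by simp) i).symm)
        (fun i => (us_ne (by simp) i).symm), MuForm.sem, Function.update_self]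
  rw [reachMu, MuForm.mem_sem_nu]
  constructor
  · rintro ⟨Z, hZ, hω⟩
    refine hθ.subset_reachSet (fun η hη => ((hb Z η).1 (hZ hη)).1) (fun η hη => ?_) hω
    obtain ⟨-, ζ, h, hx, hy⟩ := (hb Z η).1 (hZ hη)
    exact ⟨_, halfStep_put_of_eqOn h, hx, hy⟩
  -- The reachability set is itself postfixed.
  · refine fun hω => ⟨reachSet r θ, fun η hη => ?_, hω⟩
    obtain ⟨m, hm⟩ := hθ.exists_midpoint hη
    obtain ⟨ζ, hζ, rfl⟩ := exists_eqOn_restr (us r) η m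
    refine (hb _ η).2 ⟨hθ.sat_of_mem_reachSet hη, ζ, hζ, hm _ (halfStep_put_of_eqOn hζ) ?_⟩
    ext i
    exact put_of_ne (us_ne (by simp) i).symm (us_ne (by simp) i).symm _ _

theorem OnlyX.sem_reachDgl (hθ : OnlyX r θ) : (reachDgl r θ).sem = reachSet r θ := by
  classical
  ext ω
  have hb : ∀ (Z : Set (V → ℝ)) (η : V → ℝ), η ∈ (Dgl.sem
      (.seq (.assign (r .s) (r .t) (halfT r))
      (.seq (.dual (.seqs (List.ofFn fun i => .havoc (us r i))))
        (.choice (.assigns (r .s) (xs r) (us r)) (.assigns (r .s) (ys r) (us r))))) Zᶜ)ᶜ ↔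
      ∃ ζ, EqOn (put (r .s) (r .t) (η (r .t) / 2) η) ζ (range (us r))ᶜ ∧
        copy (r .s) (xs r) (us r) ζ ∈ Z ∧ copy (r .s) (ys r) (us r) ζ ∈ Z := by
    intro Z η
    -- Under the outer complement the union for the choice becomes a conjunction of both halves, and
    -- the dualised `ū := *` becomes an existential choice.
    change ¬ η ∈ (Dgl.assign (r .s) (r .t) (halfT r)).sem
      ((Dgl.seqs (List.ofFn fun i => .havoc (us r i))).sem
        ((Dgl.assigns (r .s) (xs r) (us r)).sem Zᶜ ∪
          (Dgl.assigns (r .s) (ys r) (us r)).sem Zᶜ)ᶜ)ᶜ ↔ _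
    rw [Dgl.mem_sem_assign (r.injective.ne (by simp)) (eval_halfT_update η), eval_halfT,
      mem_compl_iff, not_not, Dgl.mem_sem_seqs_havoc]
    refine exists_congr fun ζ => and_congr_right fun _ => ?_
    rw [mem_compl_iff, mem_union,
      Dgl.mem_sem_assigns (fun i => (xs_ne (by simp) i).symm)
        (fun i => (us_ne (by simp) i).symm),
      Dgl.mem_sem_assigns (fun i => (ys_ne (by simp) i).symm)
        (fun i => (us_ne (by simp) i).symm)]
    simp only [mem_compl_iff, not_or, not_not]
  rw [reachDgl, Dgl.mem_sem_box_rep]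
  constructor
  · rintro ⟨Z, hZ, hω⟩
    refine hθ.subset_reachSet (fun η hη => Dgl.mem_sem_toDgl.1 (hZ hη).1) (fun η hη => ?_) hω
    obtain ⟨ζ, h, hx, hy⟩ := (hb Z η).1 (hZ hη).2
    exact ⟨_, halfStep_of_eqOn_put h, hx, hy⟩
  · refine fun hω => ⟨reachSet r θ, fun η hη => ⟨Dgl.mem_sem_toDgl.2
      (hθ.sat_of_mem_reachSet hη), ?_⟩, hω⟩
    obtain ⟨m, hm⟩ := hθ.exists_midpoint hη
    obtain ⟨ζ, hζ, rfl⟩ := exists_eqOn_restr (us r) (put (r .s) (r .t) (η (r .t) / 2) η) m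
    exact (hb _ η).2 ⟨ζ, hζ, hm _ (halfStep_of_eqOn_put hζ) rfl⟩

end Reachability

/-! ### Positivity, closedness and absence of differential equations -/

section WellFormed

namespace MuForm

theorem exs_induction {P : MuForm V W → Prop} (hex : ∀ x φ, P φ → P (ex x φ)) (l : List V)
    {φ : MuForm V W} (h : P φ) : P (exs l φ) := by
  induction l with
  | nil => exact h
  | cons x l ih => exact hex _ _ ih

theorem assign_induction {P : MuForm V W → Prop} (heq : ∀ a b, P (eq a b))
    (hand : ∀ φ ψ, P φ → P ψ → P (and φ ψ)) (hex : ∀ x φ, P φ → P (ex x φ)) (s x : V)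
    (a : Term V) {φ : MuForm V W} (h : P φ) : P (assign s x a φ) :=
  hex _ _ (hand _ _ (heq _ _) (hex _ _ (hand _ _ (heq _ _) h)))

theorem assigns_induction {P : MuForm V W → Prop} (heq : ∀ a b, P (eq a b))
    (hand : ∀ φ ψ, P φ → P ψ → P (and φ ψ)) (hex : ∀ x φ, P φ → P (ex x φ)) {n : ℕ} (s : V)
    (x y : Fin n ↪ V) {φ : MuForm V W} (h : P φ) : P (assigns s x y φ) := by
  rw [assigns]
  generalize (List.ofFn fun i => (x i, y i)) = l
  induction l with
  | nil => exact h
  | cons p l ih => exact assign_induction heq hand hex _ _ _ ih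

theorem wellFormed_toMu (X : W) (φ : FOForm V) :
    (φ.toMu W).WF ∧ (φ.toMu W).ODEFree ∧ (φ.toMu W).fixFv = ∅ ∧
      ∀ p, Polar X p (φ.toMu W) := by
  induction φ with
  | eq a b => simp [FOForm.toMu, WF, ODEFree, fixFv, Polar]
  | neg φ ih => simp [FOForm.toMu, WF, ODEFree, fixFv, Polar, ih]
  | and φ ψ h1 h2 => simp [FOForm.toMu, WF, ODEFree, fixFv, Polar, h1, h2]
  | ex x φ ih => simp [FOForm.toMu, ex, WF, ODEFree, Act.ODEFree, fixFv, Polar, ih]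

theorem substFix_toMu (X : W) (ρ : MuForm V W) (φ : FOForm V) :
    substFix X ρ (φ.toMu W) = φ.toMu W := by
  induction φ <;> simp_all [FOForm.toMu, substFix, ex]

/-- `ν` unfolds to a `μ` over the negation of the substituted body, so positivity under `μ` requires
negative polarity in that body. -/
theorem wellFormed_nu {X : W} {φ : MuForm V W}
    (h : (substFix X (neg (fix X)) φ).WF ∧ (substFix X (neg (fix X)) φ).ODEFree ∧
      (substFix X (neg (fix X)) φ).fixFv ⊆ {X} ∧
      Polar X false (substFix X (neg (fix X)) φ)) :
    (nu X φ).WF ∧ (nu X φ).ODEFree ∧ (nu X φ).fixFv = ∅ :=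
  ⟨⟨h.2.2.2, h.1⟩, h.2.1, sdiff_eq_empty.2 h.2.2.1⟩

end MuForm

open MuForm in
theorem wellFormed_reachMu (r : Role ℓ ↪ V) (X : W) (θ : Fin ℓ → Term V) :
    (reachMu r X θ).WF ∧ (reachMu r X θ).ODEFree ∧ (reachMu r X θ).fixFv = ∅ := by
  refine wellFormed_nu ?_
  let P : MuForm V W → Prop := fun φ => (substFix X (neg (fix X)) φ).WF ∧
    (substFix X (neg (fix X)) φ).ODEFree ∧ (substFix X (neg (fix X)) φ).fixFv ⊆ {X} ∧
      Polar X false (substFix X (neg (fix X)) φ)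
  have heq : ∀ a b, P (eq a b) := fun a b => by simp [P, substFix, WF, ODEFree, fixFv, Polar]
  have hand : ∀ φ ψ, P φ → P ψ → P (and φ ψ) := fun φ ψ h1 h2 =>
    ⟨⟨h1.1, h2.1⟩, ⟨h1.2.1, h2.2.1⟩, union_subset h1.2.2.1 h2.2.2.1, ⟨h1.2.2.2, h2.2.2.2⟩⟩
  have hex : ∀ x φ, P φ → P (ex x φ) := fun x φ h => ⟨h.1, ⟨trivial, h.2.1⟩, h.2.2⟩
  have hfix : P (fix X) := by simp [P, substFix, WF, ODEFree, fixFv, Polar]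
  change P _
  refine hand _ _ ?_ (exs_induction hex _ (assign_induction heq hand hex _ _ _ (hand _ _
    (assigns_induction heq hand hex _ _ _ hfix) (assigns_induction heq hand hex _ _ _ hfix))))
  have := wellFormed_toMu X (taylorForm r θ)
  simp only [P, substFix_toMu]
  exact ⟨this.1, this.2.1, by simp [this.2.2.1], this.2.2.2 _⟩

namespace Dgl

theorem odeFree_toDgl (φ : FOForm V) : φ.toDgl.ODEFree := by
  induction φ with
  | eq a b => trivial
  | neg φ ih => exact ih
  | and φ ψ h1 h2 => exact ⟨h1, h2⟩
  | ex x φ ih => exact ⟨trivial, ih⟩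

theorem odeFree_seqs {l : List (Dgl V .game)} (h : ∀ α ∈ l, α.ODEFree) : (seqs l).ODEFree := by
  induction l with
  | nil => trivial
  | cons α l ih =>
    exact ⟨h α List.mem_cons_self, ih fun β hβ => h β (List.mem_cons_of_mem _ hβ)⟩

theorem odeFree_assign (s x : V) (a : Term V) : (assign s x a).ODEFree :=
  ⟨trivial, trivial, trivial, trivial⟩

theorem odeFree_assigns {n : ℕ} (s : V) (x y : Fin n ↪ V) : (assigns s x y).ODEFree := by
  refine odeFree_seqs fun α hα => ?_
  obtain ⟨i, rfl⟩ := List.mem_ofFn.1 hα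
  exact odeFree_assign _ _ _

end Dgl

open Dgl in
theorem odeFree_reachDgl (r : Role ℓ ↪ V) (θ : Fin ℓ → Term V) : (reachDgl r θ).ODEFree := by
  refine ⟨⟨odeFree_assign _ _ _, odeFree_seqs fun α hα => ?_, odeFree_assigns _ _ _,
    odeFree_assigns _ _ _⟩, odeFree_toDgl _⟩
  obtain ⟨i, rfl⟩ := List.mem_ofFn.1 hα
  trivial

end WellFormed

variable {V : Type u} {W : Type v}

/-! ### Truth does not depend on variables that are not free -/

section Independence

/-- Membership in `S` does not depend on the values of the variables in `B`. -/
def Indep (B : Set V) (S : Set (V → ℝ)) : Prop :=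
  ∀ ω η : V → ℝ, EqOn ω η Bᶜ → (ω ∈ S ↔ η ∈ S)

theorem Indep.of_imp {B : Set V} {S : Set (V → ℝ)}
    (h : ∀ ω η : V → ℝ, EqOn ω η Bᶜ → ω ∈ S → η ∈ S) : Indep B S :=
  fun ω η e => ⟨h ω η e, h η ω e.symm⟩

theorem Indep.mono {B B' : Set V} {S : Set (V → ℝ)} (h : Indep B S) (hB : B' ⊆ B) :
    Indep B' S := fun ω η e => h ω η (e.mono (compl_subset_compl.2 hB))

theorem Indep.compl {B : Set V} {S : Set (V → ℝ)} (h : Indep B S) : Indep B Sᶜ :=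
  fun ω η e => not_congr (h ω η e)

theorem Indep.inter {B : Set V} {S T : Set (V → ℝ)} (h : Indep B S) (h' : Indep B T) :
    Indep B (S ∩ T) := fun ω η e => and_congr (h ω η e) (h' ω η e)

theorem Indep.union {B : Set V} {S T : Set (V → ℝ)} (h : Indep B S) (h' : Indep B T) :
    Indep B (S ∪ T) := fun ω η e => or_congr (h ω η e) (h' ω η e)

theorem indep_eq {B : Set V} {a b : Term V} (h : Disjoint (a.fv ∪ b.fv) B) :
    Indep B {ω | a.eval ω = b.eval ω} := by
  intro ω η e
  have h' := e.mono (subset_compl_iff_disjoint_right.2 h)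
  simp only [mem_ofPred_eq, Term.eval_congr (h'.mono subset_union_left),
    Term.eval_congr (h'.mono subset_union_right)]

/-- The action overwrites `x`, so outcomes from states differing only on `B` differ only on `B \
range x`. -/
theorem indep_atomWin {B : Set V} {k l : ℕ} {a : Act k l} {x : Fin k ↪ V} {θ : Fin l → Term V}
    {S : Set (V → ℝ)} (hθ : Disjoint (⋃ i, (θ i).fv) B) (hS : Indep (B \ range x) S) :
    Indep B (atomWin a x θ S) := by
  refine .of_imp fun ω η e ⟨E, hE, h⟩ => ⟨E, ?_, fun b hb => ?_⟩
  · have : (fun i => (θ i).eval η) = fun i => (θ i).eval ω := funext fun i =>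
      Term.eval_congr (e.symm.mono ((subset_iUnion (fun i => (θ i).fv) i).trans
        (subset_compl_iff_disjoint_right.2 hθ)))
    rwa [this]
  · refine (hS _ _ fun v hv => ?_).1 (h b hb)
    by_cases hx : ∃ j, x j = v
    · obtain ⟨j, rfl⟩ := hx
      simp only [x.injective.extend_apply]
    · rw [Function.extend_apply' _ _ _ hx, Function.extend_apply' _ _ _ hx]
      exact e fun hB => hv ⟨hB, hx⟩

/-- The least fixpoint of a monotone operator preserving independence is independent. -/
theorem indep_sInter_prefixed {B : Set V} {f : Set (V → ℝ) → Set (V → ℝ)} (hf : Monotone f)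
    (h : ∀ Z, Indep B Z → Indep B (f Z)) : Indep B (⋂₀ {Z | f Z ⊆ Z}) := by
  set μ := ⋂₀ {Z | f Z ⊆ Z} with hμ
  have hfix : f μ ⊆ μ := subset_sInter fun Z hZ => (hf (sInter_subset_of_mem hZ)).trans hZ
  -- `C` is the largest independent subset of `μ`. It is again prefixed, so leastness forces `μ ⊆
  -- C`.
  let C : Set (V → ℝ) := {ω | ∀ η, EqOn ω η Bᶜ → η ∈ μ}
  have hC : Indep B C := .of_imp fun ω η e h ξ e' => h ξ (e.trans e')
  have hCμ : C ⊆ μ := fun ω h => h ω fun _ _ => rfl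
  have hfC : f C ⊆ C := fun ω hω η e => hfix (hf hCμ ((h C hC ω η e).1 hω))
  have hμC : μ ⊆ C := sInter_subset_of_mem hfC
  exact .of_imp fun ω η e hω => hμC hω η e

end Independence

/-! ### Independence in the `μ`-calculus -/

namespace MuForm

-- Negation swaps polarities, so monotonicity and antitonicity must be proved by one induction.
open Classical in
theorem sem_mono_of_polar {X : W} {Z Z' : Set (V → ℝ)} (hZ : Z ⊆ Z') (φ : MuForm V W)
    (I : W → Set (V → ℝ)) :
    (Polar X true φ → φ.sem (Function.update I X Z) ⊆ φ.sem (Function.update I X Z')) ∧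
      (Polar X false φ → φ.sem (Function.update I X Z') ⊆ φ.sem (Function.update I X Z)) := by
  induction φ generalizing I with
  | fix Y =>
    by_cases h : Y = X
    · subst h; simpa [sem, Polar] using hZ
    · simp [sem, h]
  | eq a b => exact ⟨fun _ => le_rfl, fun _ => le_rfl⟩
  | neg φ ih =>
    exact ⟨fun h => compl_subset_compl.2 ((ih I).2 h), fun h => compl_subset_compl.2 ((ih I).1 h)⟩
  | and φ ψ h1 h2 =>
    exact ⟨fun h => inter_subset_inter ((h1 I).1 h.1) ((h2 I).1 h.2),
      fun h => inter_subset_inter ((h1 I).2 h.1) ((h2 I).2 h.2)⟩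
  | dia a x θ φ ih => exact ⟨fun h => atomWin_mono ((ih I).1 h), fun h => atomWin_mono ((ih I).2 h)⟩
  | mu Y φ ih =>
    by_cases h : Y = X
    · subst h; simp [sem]
    · simp only [sem, Polar, ne_eq, h, not_false_eq_true, forall_const, Function.update_comm (Ne.symm h)]
      exact ⟨fun hp => sInter_subset_sInter fun U hU => ((ih _).1 hp).trans hU,
        fun hp => sInter_subset_sInter fun U hU => ((ih _).2 hp).trans hU⟩

open Classical in
/-- The truth of a formula does not depend on variables which are not free. -/
theorem indep_sem {φ : MuForm V W} (hwf : φ.WF) {B : Set V} (hB : Disjoint φ.fv B)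
    {I : W → Set (V → ℝ)} (hI : ∀ Y ∈ φ.fixFv, Indep B (I Y)) : Indep B (φ.sem I) := by
  induction φ generalizing B I with
  | fix Y => exact hI Y rfl
  | eq a b => exact indep_eq hB
  | neg φ ih => exact (ih hwf hB hI).compl
  | and φ ψ h1 h2 =>
    exact (h1 hwf.1 (hB.mono_left subset_union_left) fun Y hY => hI Y (Or.inl hY)).inter
      (h2 hwf.2 (hB.mono_left subset_union_right) fun Y hY => hI Y (Or.inr hY))
  | dia a x θ φ ih =>
    refine indep_atomWin (hB.mono_left subset_union_left) (ih hwf ?_ fun Y hY =>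
      (hI Y hY).mono sdiff_subset)
    have := hB.mono_left (show φ.fv \ range x ⊆ _ from subset_union_right)
    rw [disjoint_left] at this ⊢
    exact fun v hv hv' => this ⟨hv, hv'.2⟩ hv'.1
  | mu X φ ih =>
    refine indep_sInter_prefixed (fun Z Z' h => (sem_mono_of_polar h φ I).1 hwf.1)
      fun Z hZ => ih hwf.2 hB fun Y hY => ?_
    by_cases h : Y = X
    · subst h; simpa using hZ
    · rw [Function.update_of_ne h]
      exact hI Y ⟨hY, h⟩

end MuForm

/-! ### Monotonicity and independence in game logic -/

namespace Dgl

/-- Monotonicity of winning regions in the goal. -/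
def MonoSem : {κ : Kind} → Dgl V κ → Prop
  | .form, _ => True
  | .game, α => Monotone α.sem

theorem monoSem {κ : Kind} (α : Dgl V κ) : MonoSem α := by
  induction α with
  | eq a b => trivial
  | neg φ ih => trivial
  | and φ ψ h1 h2 => trivial
  | dia α φ h1 h2 => trivial
  | atom a x θ => exact fun S T h => atomWin_mono h
  | test φ ih => exact fun S T h => inter_subset_inter_right _ h
  | choice α β h1 h2 => exact fun S T h => union_subset_union (h1 h) (h2 h)
  | seq α β h1 h2 => exact fun S T h => h1 (h2 h)
  | rep α ih =>
    exact fun S T h => sInter_subset_sInter fun Z hZ =>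
      (union_subset_union_left _ h).trans hZ
  | dual α ih => exact fun S T h => compl_subset_compl.2 (ih (compl_subset_compl.2 h))

/-- The denotation does not depend on variables which are not free. -/
def IndepSem : {κ : Kind} → Dgl V κ → Prop
  | .form, φ => ∀ B : Set V, Disjoint φ.fv B → Indep B φ.sem
  | .game, α => ∀ B : Set V, Disjoint α.fv B → ∀ S, Indep (B \ α.mbv) S → Indep B (α.sem S)

theorem disjoint_sdiff_of {A B C : Set V} (h : Disjoint (A \ C) B) : Disjoint A (B \ C) := by
  rw [disjoint_left] at h ⊢
  exact fun v hv hv' => h ⟨hv, hv'.2⟩ hv'.1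

theorem indepSem {κ : Kind} (α : Dgl V κ) : IndepSem α := by
  induction α with
  | eq a b => exact fun B hB => indep_eq hB
  | neg φ ih => exact fun B hB => (ih B hB).compl
  | and φ ψ h1 h2 =>
    exact fun B hB => (h1 B (hB.mono_left subset_union_left)).inter
      (h2 B (hB.mono_left subset_union_right))
  | dia α φ h1 h2 =>
    exact fun B hB => h1 B (hB.mono_left subset_union_left) _
      (h2 _ (disjoint_sdiff_of (hB.mono_left subset_union_right)))
  | atom a x θ => exact fun B hB S hS => indep_atomWin hB hS
  | test φ ih => exact fun B hB S hS => (ih B hB).inter (hS.mono (by simp [mbv]))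
  | choice α β h1 h2 =>
    exact fun B hB S hS =>
      (h1 B (hB.mono_left subset_union_left) S
        (hS.mono (sdiff_subset_sdiff_right inter_subset_left))).union
      (h2 B (hB.mono_left subset_union_right) S
        (hS.mono (sdiff_subset_sdiff_right inter_subset_right)))
  | seq α β h1 h2 =>
    exact fun B hB S hS => h1 B (hB.mono_left subset_union_left) _
      (h2 _ (disjoint_sdiff_of (hB.mono_left subset_union_right)) S
        (hS.mono (by rw [mbv, sdiff_sdiff])))
  | rep α ih =>
    intro B hB S hS
    have hS' : Indep B S := hS.mono (by simp [mbv])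
    exact indep_sInter_prefixed (fun Z Z' h => union_subset_union_right _ (monoSem α h))
      fun Z hZ => hS'.union (ih B hB Z (hZ.mono sdiff_subset))
  | dual α ih => exact fun B hB S hS => (ih B hB _ hS.compl).compl

theorem indep_sem {φ : Dgl V .form} {B : Set V} (hB : Disjoint φ.fv B) : Indep B φ.sem :=
  indepSem φ B hB

end Dgl

/-! ### Soundness of the axiom -/

section Axiom

variable {V : Type u} {W : Type v} {ℓ : ℕ} {r : Role ℓ ↪ V} {θ : Fin ℓ → Term V}

theorem nablaBound_subset : nablaBound r ⊆ range r := by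
  rintro v ((rfl | rfl | rfl) | ⟨i, rfl⟩) <;> exact ⟨_, rfl⟩

theorem xs_notMem_nablaBound (i : Fin ℓ) : xs r i ∉ nablaBound r := by
  rintro ((h | h | h) | ⟨j, h⟩) <;> cases r.injective h

/-- The jump `x̄ := ȳ` and the evolution end in states that may differ only on `K, ȳ, t, s`, which
an independent goal cannot distinguish. The variables `ū` and `z̄` are changed only inside the
reachability formula, so they need not be fresh. -/
theorem eqOn_copy_extend {ω ζ : V → ℝ} (h : EqOn ω ζ (nablaBound r)ᶜ) :
    EqOn (copy (r .s) (xs r) (ys r) ζ)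
      (Function.extend (xs r) (fun i => restr ζ (ys r) i) ω) (nablaBound r)ᶜ := by
  intro v hv
  by_cases hx : ∃ j, xs r j = v
  · obtain ⟨j, rfl⟩ := hx
    rw [(xs r).injective.extend_apply]
    exact copy_apply (fun i => (xs_ne (by simp) i).symm) (fun i => (ys_ne (by simp) i).symm)
      (fun i j => ys_ne (ρ := .x i) (by simp) j) ζ j
  · rw [Function.extend_apply' _ _ _ hx, copy_of_ne (fun e => hv (by simp [nablaBound, e]))
      (fun i e => hx ⟨i, e.symm⟩), h hv]

open Classical in
/-- Evolving along the differential equation is jumping to a reachable point. -/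
theorem OnlyX.mem_atomWin_odeAct (hθ : OnlyX r θ) (hfv : ∀ i, (θ i).fv ⊆ range (xs r))
    {S : Set (V → ℝ)} (hS : Indep (nablaBound r) S) (ω : V → ℝ) :
    ω ∈ atomWin (odeAct (xs r) θ) (xs r) (fun i => .var (xs r i)) S ↔
      ∃ c, ∃ η, EqOn (Function.update ω (r .K) c) η (range (ys r))ᶜ ∧
        ∃ d, Function.update η (r .t) d ∈ reachSet r θ ∧
          copy (r .s) (xs r) (ys r) (Function.update η (r .t) d) ∈ S := by
  rw [odeAct, mem_atomWin_dyn, polyField_toPoly _ _ ω hfv]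
  have hoff : ∀ c η d, EqOn (Function.update ω (r .K) c) η (range (ys r))ᶜ →
      EqOn ω (Function.update η (r .t) d) (nablaBound r)ᶜ := fun c η d h v hv => by
    simp only [nablaBound, mem_compl_iff, mem_union, mem_insert_iff, mem_singleton_iff,
      not_or] at hv
    rw [Function.update_of_ne hv.1.2.1, ← h hv.2, Function.update_of_ne hv.1.1]
  have hx : ∀ ζ : V → ℝ, EqOn ω ζ (nablaBound r)ᶜ → restr ζ (xs r) = restr ω (xs r) :=
    fun ζ h => by
      ext i
      exact (h (xs_notMem_nablaBound i)).symm
  have hf : ∀ ζ : V → ℝ, EqOn ω ζ (nablaBound r)ᶜ →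
      termField (xs r) θ ζ = termField (xs r) θ ω := fun ζ h =>
    (hθ.termField_eq (h.mono (compl_subset_compl.2 nablaBound_subset))).symm
  constructor
  · rintro ⟨t, b, h, hb⟩
    -- The bound comes from compactness of the trajectory; in the converse direction the ball is
    -- simply forgotten.
    obtain ⟨K, hK⟩ := h.exists_bar
    obtain ⟨η, hη, rfl⟩ := exists_eqOn_restr (ys r) (Function.update ω (r .K) K) b
    have e := hoff K η t hη
    have hy : restr (Function.update η (r .t) t) (ys r) = restr η (ys r) := by
      ext i
      exact update_role (σ := .y i) η (by simp) t
    refine ⟨K, η, hη, t, ?_, ?_⟩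
    · rw [reachSet, mem_ofPred_eq, hx _ e, hf _ e, hy, Function.update_self,
        update_role _ (by simp), ← hη, Function.update_self]
      · exact hK
      · rintro ⟨i, hi⟩
        exact ys_ne (ρ := .K) (by simp) i hi.symm
    · refine (hS _ _ (eqOn_copy_extend e)).2 ?_
      rwa [hy]
  · rintro ⟨c, η, hη, d, hr, hS'⟩
    have e := hoff c η d hη
    refine ⟨Function.update η (r .t) d (r .t), _, ?_, (hS _ _ (eqOn_copy_extend e)).1 hS'⟩
    rw [← hx _ e, ← hf _ e]
    exact hr.mono (subset_univ _)

open Classical in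
theorem OnlyX.mem_sem_nablaMu (hθ : OnlyX r θ) (hfv : ∀ i, (θ i).fv ⊆ range (xs r)) (X : W)
    {φ : MuForm V W} {I : W → Set (V → ℝ)} (hS : Indep (nablaBound r) (φ.sem I)) (ω : V → ℝ) :
    ω ∈ (nablaMu r X θ φ).sem I := by
  rw [nablaMu, MuForm.mem_sem_iff]
  refine (hθ.mem_atomWin_odeAct hfv hS ω).trans ?_
  rw [MuForm.mem_sem_ex]
  refine exists_congr fun c => ?_
  rw [MuForm.mem_sem_exs, setOf_notMem_ofFn]
  refine exists_congr fun η => and_congr_right fun _ => ?_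
  rw [MuForm.mem_sem_ex]
  refine exists_congr fun d => ?_
  rw [MuForm.sem, mem_inter_iff, hθ.sem_reachMu, MuForm.mem_sem_assigns
    (fun i => (xs_ne (by simp) i).symm) (fun i => (ys_ne (by simp) i).symm)]

open Classical in
theorem OnlyX.mem_sem_nablaDgl (hθ : OnlyX r θ) (hfv : ∀ i, (θ i).fv ⊆ range (xs r))
    {φ : Dgl V .form} (hS : Indep (nablaBound r) φ.sem) (ω : V → ℝ) :
    ω ∈ (nablaDgl r θ φ).sem := by
  refine Dgl.mem_sem_iff.2 ((hθ.mem_atomWin_odeAct hfv hS ω).trans ?_)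
  refine Iff.symm (Dgl.mem_sem_ex.trans (exists_congr fun c => Dgl.mem_sem_exs.trans ?_))
  rw [setOf_notMem_ofFn]
  refine exists_congr fun η => and_congr_right fun _ => Dgl.mem_sem_ex.trans ?_
  refine exists_congr fun d => and_congr ?_ (Dgl.mem_sem_assigns
    (fun i => (xs_ne (by simp) i).symm) (fun i => (ys_ne (by simp) i).symm))
  rw [hθ.sem_reachDgl]

end Axiom

end DGL

theorem mainTheorem10 {V : Type*} {W : Type*} {ℓ : ℕ} (r : DGL.Role ℓ ↪ V) (X : W)
    (θ : Fin ℓ → DGL.Term V)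
    (hθ : ∀ i, ∀ ρ : DGL.Role ℓ, r ρ ∈ (θ i).fv → ∃ j, ρ = DGL.Role.x j) :
    -- the Taylor bound formula defines the Taylor bound
    (∀ ω : V → ℝ, (DGL.taylorForm r θ).Sat ω ↔
      (DGL.restr ω (DGL.xs r), DGL.restr ω (DGL.ys r), ω (r .t)) ∈
        DGL.taylorSet (DGL.termField (DGL.xs r) θ ω) (ω (r .K))) ∧
    -- the two formulas are legitimate formulas without differential equations
    ((DGL.reachMu r X θ).WF ∧ (DGL.reachMu r X θ).ODEFree ∧ (DGL.reachMu r X θ).fixFv = ∅ ∧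
      (DGL.reachDgl r θ).ODEFree) ∧
    -- they define bounded continuous reachability
    (∀ ω : V → ℝ,
      (∀ I : W → Set (V → ℝ),
        DGL.ReachIn (DGL.termField (DGL.xs r) θ ω) (DGL.bar ℓ (ω (r .K))) (ω (r .t))
            (DGL.restr ω (DGL.xs r)) (DGL.restr ω (DGL.ys r)) ↔
          ω ∈ (DGL.reachMu r X θ).sem I) ∧
      (DGL.ReachIn (DGL.termField (DGL.xs r) θ ω) (DGL.bar ℓ (ω (r .K))) (ω (r .t))
          (DGL.restr ω (DGL.xs r)) (DGL.restr ω (DGL.ys r)) ↔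
        ω ∈ (DGL.reachDgl r θ).sem)) ∧
    -- soundness of the fixpoint axiom in both logics
    ((∀ i, (θ i).fv ⊆ Set.range (DGL.xs r)) →
      (∀ φ : DGL.MuForm V W, φ.WF → Disjoint φ.fv (DGL.nablaBound r) →
        ∀ I : W → Set (V → ℝ),
          (∀ Y ∈ φ.fixFv, ∀ ω η : V → ℝ, Set.EqOn ω η (DGL.nablaBound r)ᶜ →
            (ω ∈ I Y ↔ η ∈ I Y)) →
          ∀ ω : V → ℝ, ω ∈ (DGL.nablaMu r X θ φ).sem I) ∧
      (∀ φ : DGL.Dgl V .form, Disjoint φ.fv (DGL.nablaBound r) →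
        ∀ ω : V → ℝ, ω ∈ (DGL.nablaDgl r θ φ).sem)) := by
  have h : DGL.OnlyX r θ := hθ
  refine ⟨h.sat_taylorForm, ?_, fun ω => ⟨fun I => ?_, ?_⟩, fun hfv => ⟨?_, ?_⟩⟩
  · obtain ⟨h1, h2, h3⟩ := DGL.wellFormed_reachMu r X θ
    exact ⟨h1, h2, h3, DGL.odeFree_reachDgl r θ⟩
  · rw [h.sem_reachMu]
    rfl
  · rw [h.sem_reachDgl]
    rfl
  · exact fun φ hwf hB I hI => h.mem_sem_nablaMu hfv X (DGL.MuForm.indep_sem hwf hB hI)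
  · exact fun φ hB => h.mem_sem_nablaDgl hfv (DGL.Dgl.indep_sem hB)
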